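/- Let $K$ be a field of characteristic different from $2$. Let $E$ be a directed graph (of arbitrary size) with vertex set $E^0=B\sqcup F$, edge set $E^1$, source and range maps $s,r:E^1\to E^0$. Vertices in $B$ are called Bosonic, those in $F$ Fermionic; an edge is Bosonic if its source and range both lie in $B$. For each edge $e$ let $e^*$ be a ghost edge, with $s(e^*)=r(e)$ and $r(e^*)=s(e)$; an *arrow* is an edge or a ghost edge. A vertex is regular if it emits at least one and only finitely many edges. The Leavitt path superalgebra $SL_K(E)$ is the (not necessarily unital) associative $K$-algebra generated by the vertices, edges and ghost edges, subject to the following relations. 1. $vv'=\delta_{v,v'}v$ for $v,v'\in B$; $ww'=-w'w$ for $w,w'\in F$ (so $w^2=0$); $vw=wv$ for $v\in B$, $w\in F$. 2. For each arrow $a$: $s(a)a=a$ if $s(a)\in B$ and $s(a)a=0$ if $s(a)\in F$; $a\,r(a)=a$ if $r(a)\in B$ and $a\,r(a)=0$ if $r(a)\in F$. 3. $e^*e=r(e)$ if $e$ is a Bosonic edge, $e^*e=0$ for every other edge $e$, and $e^*e'=0$ if $e\ne e'$ are both Bosonic edges. 4. $v=\sum_{s(e)=v,\ r(e)\in B}ee^*$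 for each regular $v\in B$. 5. $ab=a\,r(a)s(b)\,b$, $\;ua=u\,s(a)\,a$ and $au=a\,r(a)\,u$ for all arrows $a,b$ and all vertices $u$. Assume that every regular Bosonic vertex $v$ emits a Bosonic edge, and choose one such edge $\gamma(v)$ for each of them; the chosen edges are called special. Fix a linear order on $E^0$. Call a non-empty word in the generators *irreducible* if none of its contiguous subwords is one of the following, where $v,v'\in B$, $w,w'\in F$, $a,b$ are arrows, $x$ is any generator, $e,e'$ are edges, and $W$ is a possibly empty word in Fermionic vertices: * $vv'$; $\;ww'$ with $w'\le w$; $\;wv$; $\;av$; $\;vWa$; * $aWb$ with $r(a)\neq s(b)$; $\;xa$ with $s(a)\in F$; $\;ax$ with $r(a)\in F$; * $e^*e$; $\;e^*e'$ with $e\ne e'$ both Bosonic; $\;ee^*$ with $e$ special. Then the following words form a $K$-basis of $SL_K(E)$ (distinct words giving distinct basis elements): 1. the vertices $v\in B\cup F$; 2. $p$ and $p^*=e_n^*\cdots e_1^*$, where $p=e_1e_2\cdots e_n$ ($n\ge1$) is a path in $E$ with $r(e_i)=s(e_{i+1})\in B$ for $1\le i\le n-1$; 3. $pq^*$, where $p,q$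 are paths as in (2), $r(p)=r(q)\in B$, and the last edges of $p$ and $q$ are distinct, or equal but not special; 4. the irreducible words that are products of words of types (1)–(3). -/

import Mathlib

namespace LeavittSuper

/-- A directed graph with vertex set `V`, edge set `E` and a partition of the vertices into
Bosonic ones (the set `bos`) and Fermionic ones (its complement). No finiteness is assumed. -/
structure SuperGraph (V E : Type*) where
  src : E → V
  rng : E → V
  bos : Set V

/-- The arrows of the extended graph: the edges `e` and the ghost edges `e*`. -/
inductive Arrow (E : Type*) where
  | real (e : E)
  | ghost (e : E)

/-- The generators: vertices, edges and ghost edges. -/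
inductive Letter (V E : Type*) where
  | vert (v : V)
  | arr (a : Arrow E)

namespace SuperGraph

variable {V E : Type*} (G : SuperGraph V E)

/-- Source of an arrow of the extended graph; `s(e*) = r(e)`. -/
def asrc : Arrow E → V
  | .real e => G.src e
  | .ghost e => G.rng e

/-- Range of an arrow of the extended graph; `r(e*) = s(e)`. -/
def arng : Arrow E → V
  | .real e => G.rng e
  | .ghost e => G.src e

/-- An edge is Bosonic if both its endpoints are Bosonic. -/
def IsBosonicEdge (e : E) : Prop := G.src e ∈ G.bos ∧ G.rng e ∈ G.bos

/-- A vertex is regular if it emits at least one and only finitely many edges. -/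
def IsRegular (v : V) : Prop := {e | G.src e = v}.Nonempty ∧ {e | G.src e = v}.Finite

/-- The set of regular Bosonic vertices. -/
def regBos : Set V := {v | v ∈ G.bos ∧ G.IsRegular v}

end SuperGraph

section Algebra

variable (K : Type*) [Field K] {V E : Type*} (G : SuperGraph V E)

/-- The vertex `v` in the free algebra on the generators. -/
def fv (E : Type*) {V : Type*} (v : V) : FreeAlgebra K (Letter V E) :=
  FreeAlgebra.ι K (Letter.vert v)

/-- The arrow `a` (edge or ghost edge) in the free algebra on the generators. -/
def fa (V : Type*) {E : Type*} (a : Arrow E) : FreeAlgebra K (Letter V E) :=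
  FreeAlgebra.ι K (Letter.arr a)

/-- The defining relations of the Leavitt path superalgebra. The relations between an edge or a
ghost edge and its endpoints are stated uniformly for all arrows `a` of the extended graph. -/
inductive Rel : FreeAlgebra K (Letter V E) → FreeAlgebra K (Letter V E) → Prop
  -- products of vertices
  | bos_idem (v : V) : v ∈ G.bos → Rel (fv K E v * fv K E v) (fv K E v)
  | bos_orth (v v' : V) : v ∈ G.bos → v' ∈ G.bos → v ≠ v' → Rel (fv K E v * fv K E v') 0
  | fer_anti (w w' : V) : w ∉ G.bos → w' ∉ G.bos →
      Rel (fv K E w * fv K E w') (-(fv K E w' * fv K E w))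
  | bos_fer (v w : V) : v ∈ G.bos → w ∉ G.bos →
      Rel (fv K E v * fv K E w) (fv K E w * fv K E v)
  -- `s(a) a` and `a r(a)`
  | src_bos (a : Arrow E) : G.asrc a ∈ G.bos → Rel (fv K E (G.asrc a) * fa K V a) (fa K V a)
  | src_fer (a : Arrow E) : G.asrc a ∉ G.bos → Rel (fv K E (G.asrc a) * fa K V a) 0
  | rng_bos (a : Arrow E) : G.arng a ∈ G.bos → Rel (fa K V a * fv K E (G.arng a)) (fa K V a)
  | rng_fer (a : Arrow E) : G.arng a ∉ G.bos → Rel (fa K V a * fv K E (G.arng a)) 0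
  -- `e* e'`
  | ghost_self_bos (e : E) : G.IsBosonicEdge e →
      Rel (fa K V (.ghost e) * fa K V (.real e)) (fv K E (G.rng e))
  | ghost_self_fer (e : E) : ¬ G.IsBosonicEdge e →
      Rel (fa K V (.ghost e) * fa K V (.real e)) 0
  | ghost_ne (e e' : E) : G.IsBosonicEdge e → G.IsBosonicEdge e' → e ≠ e' →
      Rel (fa K V (.ghost e) * fa K V (.real e')) 0
  -- `v = ∑ e e*` over the Bosonic edges leaving a regular Bosonic vertex
  | regular (v : V) (S : Finset E) : v ∈ G.regBos →
      (∀ e, e ∈ S ↔ G.src e = v ∧ G.rng e ∈ G.bos) →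
      Rel (fv K E v) (∑ e ∈ S, fa K V (.real e) * fa K V (.ghost e))
  -- arrows are multiplied through their endpoints
  | mul_arr_arr (a b : Arrow E) :
      Rel (fa K V a * fa K V b)
        (fa K V a * (fv K E (G.arng a) * fv K E (G.asrc b)) * fa K V b)
  | mul_vert_arr (v : V) (a : Arrow E) :
      Rel (fv K E v * fa K V a) ((fv K E v * fv K E (G.asrc a)) * fa K V a)
  | mul_arr_vert (a : Arrow E) (v : V) :
      Rel (fa K V a * fv K E v) (fa K V a * (fv K E (G.arng a) * fv K E v))

/-- The unital algebra presented by the generators and relations. Since no relation has a constant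
term, it is the unitization of the non-unital algebra with the same presentation. -/
abbrev UnitalSL : Type _ := RingQuot (Rel K G)

/-- A word in the generators, evaluated in the algebra. -/
noncomputable def wordVal (u : List (Letter V E)) : UnitalSL K G :=
  RingQuot.mkAlgHom K (Rel K G) (u.map (FreeAlgebra.ι K)).prod

/-- The Leavitt path superalgebra `SL_K(E)`: the (not necessarily unital) associative `K`-algebra
generated by the vertices, edges and ghost edges subject to the relations `Rel`, realized as the
subalgebra without unit generated by these elements in the unital algebra `UnitalSL`. -/
noncomputable def SL : NonUnitalSubalgebra K (UnitalSL K G) :=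
  NonUnitalAlgebra.adjoin K (Set.range fun x : Letter V E => wordVal K G [x])

end Algebra

section Words

variable {V E : Type*} (G : SuperGraph V E)

/-- The word of a path `e₁ e₂ ⋯ eₙ`. -/
def pathWord (p : List E) : List (Letter V E) := p.map fun e => .arr (.real e)

/-- The word `eₙ* ⋯ e₂* e₁*` of the ghost path of `e₁ e₂ ⋯ eₙ`. -/
def ghostWord (p : List E) : List (Letter V E) := p.reverse.map fun e => .arr (.ghost e)

/-- `e₁ ⋯ eₙ` (`n ≥ 1`) is a path whose internal vertices are all Bosonic. -/
def IsInnerBosonicPath (p : List E) : Prop :=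
  p ≠ [] ∧ p.IsChain fun e f => G.rng e = G.src f ∧ G.rng e ∈ G.bos

/-- A choice of special edges: for each regular Bosonic vertex `v` a Bosonic edge leaving `v`. -/
structure SpecialEdges where
  edge : G.regBos → E
  src_edge : ∀ v, G.src (edge v) = v
  rng_edge : ∀ v, G.rng (edge v) ∈ G.bos

variable {G}

/-- The edge `e` is special. -/
def SpecialEdges.IsSpecial (γ : SpecialEdges G) (e : E) : Prop := ∃ v, γ.edge v = e

/-- The elements to be multiplied: vertices, paths and ghost paths with Bosonic internal vertices,
and products `p q*` of such with common Bosonic range whose last edges are distinct, or equal but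
not special. -/
inductive IsBasicWord (γ : SpecialEdges G) : List (Letter V E) → Prop
  | vert (v : V) : IsBasicWord γ [.vert v]
  | path (p : List E) : IsInnerBosonicPath G p → IsBasicWord γ (pathWord p)
  | ghostPath (p : List E) : IsInnerBosonicPath G p → IsBasicWord γ (ghostWord p)
  | pathGhost (p q : List E) (e f : E) :
      IsInnerBosonicPath G (p ++ [e]) → IsInnerBosonicPath G (q ++ [f]) →
      G.rng e = G.rng f → G.rng e ∈ G.bos → (e ≠ f ∨ ¬ γ.IsSpecial e) →
      IsBasicWord γ (pathWord (p ++ [e]) ++ ghostWord (q ++ [f]))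

/-- The words that are rewritten by the defining relations and their immediate consequences,
for the given ordering of the Fermionic vertices and the given special edges.
In the clauses with a list `W`, this is a possibly empty list of Fermionic vertices: a Bosonic
vertex can be moved past it. -/
inductive IsReducibleFactor [LinearOrder V] (γ : SpecialEdges G) : List (Letter V E) → Prop
  -- `v v' = δ v`
  | bos_bos (v v' : V) : v ∈ G.bos → v' ∈ G.bos → IsReducibleFactor γ [.vert v, .vert v']
  -- `w w' = - w' w` for `w' < w`, and `w w = 0`
  | fer_fer (w w' : V) : w ∉ G.bos → w' ∉ G.bos → w' ≤ w →
      IsReducibleFactor γ [.vert w, .vert w']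
  -- `w v = v w`
  | fer_bos (w v : V) : w ∉ G.bos → v ∈ G.bos → IsReducibleFactor γ [.vert w, .vert v]
  -- `a v` is `a` or `0`
  | arr_bos (a : Arrow E) (v : V) : v ∈ G.bos → IsReducibleFactor γ [.arr a, .vert v]
  -- `v W a = W v a` is `W a` or `0`
  | bos_arr (v : V) (W : List V) (a : Arrow E) : v ∈ G.bos → (∀ w ∈ W, w ∉ G.bos) →
      IsReducibleFactor γ (.vert v :: W.map .vert ++ [.arr a])
  -- `a W b = a r(a) s(b) W b = 0` if `r(a) ≠ s(b)`
  | arr_arr (a : Arrow E) (W : List V) (b : Arrow E) : G.arng a ≠ G.asrc b →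
      (∀ w ∈ W, w ∉ G.bos) → IsReducibleFactor γ (.arr a :: W.map .vert ++ [.arr b])
  -- `x a = 0` if `s(a)` is Fermionic
  | src_fer (x : Letter V E) (a : Arrow E) : G.asrc a ∉ G.bos →
      IsReducibleFactor γ [x, .arr a]
  -- `a x = 0` if `r(a)` is Fermionic
  | rng_fer (a : Arrow E) (x : Letter V E) : G.arng a ∉ G.bos →
      IsReducibleFactor γ [.arr a, x]
  -- `e* e` is `r(e)` or `0`
  | ghost_self (e : E) : IsReducibleFactor γ [.arr (.ghost e), .arr (.real e)]
  -- `e* e' = 0` for distinct Bosonic edges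
  | ghost_bos (e e' : E) : G.IsBosonicEdge e → G.IsBosonicEdge e' → e ≠ e' →
      IsReducibleFactor γ [.arr (.ghost e), .arr (.real e')]
  -- `γ(v) γ(v)* = v - ∑ e e*`, the sum over the other Bosonic edges leaving `v`
  | special (e : E) : γ.IsSpecial e → IsReducibleFactor γ [.arr (.real e), .arr (.ghost e)]

/-- A word is irreducible if none of its contiguous subwords is rewritten. -/
def IsIrreducibleWord [LinearOrder V] (γ : SpecialEdges G) (u : List (Letter V E)) : Prop :=
  ∀ t, IsReducibleFactor γ t → ¬ t <:+: u

/-- The words of the basis: the basic ones and the irreducible (non-empty) products of basic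
ones. -/
def IsBasisWord [LinearOrder V] (γ : SpecialEdges G) (u : List (Letter V E)) : Prop :=
  IsBasicWord γ u ∨
    ∃ L : List (List (Letter V E)), L ≠ [] ∧ (∀ t ∈ L, IsBasicWord γ t) ∧
      u = L.flatten ∧ IsIrreducibleWord γ u

end Words

end LeavittSuper

/-! Irreducible words are encoded as normal forms: either a product of arrows with increasing blocks
of Fermionic vertices before, between and after them, or at most one Bosonic vertex followed by such
a block. Instead of proving confluence of a rewriting system, the proof lets the algebra act on the
free module on these forms.

Each generator acts as left multiplication followed by reduction. The operators satisfy every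
defining relation (`lift_letterOp_rel`); the substantial overlaps are those of `e* f` and of `v = ∑
f f*` with the rewriting of `γ(v) γ(v)*`. This gives the representation `formRep`.

Independence: prepending a letter to a form, when the result is irreducible, triggers no rewriting
(`exists_form_of_cons`). An irreducible word therefore sends the empty form to the basis vector of
its own encoding, and distinct words reach distinct vectors.

Spanning: reading a form as a word gives a linear map `formEval` to the algebra, and it intertwines
the action with left multiplication (`formEval_letterOp`). Every word is thus the evaluation of its
action on the empty form, hence a combination of irreducible words. Characteristic different from
`2` enters here, to obtain `w * w = 0`. The span of the non-empty forms contains the image of every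
letter, so the unit never occurs.

The basis words are exactly the non-empty irreducible words (`isBasisWord_iff`): every single letter
is basic, and basic words are irreducible. -/

namespace LeavittSuper

open scoped Classical

/-! ### Normal forms and the free module on them -/

section NormalForms

/-- The part of a normal form that follows the initial Fermionic vertices: nothing, a Bosonic
vertex (which is written before these Fermionic vertices), or an arrow, followed by an increasing
product of Fermionic vertices and a further tail. -/
inductive Core (V E : Type*) where
  | nil
  | bos (v : V)
  | cons (a : Arrow E) (S : Finset V) (c : Core V E)

variable {V E : Type*} {G : SuperGraph V E} (γ : SpecialEdges G)

/-- The product `a b` of two composable arrows is rewritten. -/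
def Clash : Arrow E → Arrow E → Prop
  | .ghost e, .real e' => e = e' ∨ G.IsBosonicEdge e ∧ G.IsBosonicEdge e'
  | .real e, .ghost e' => e = e' ∧ γ.IsSpecial e
  | _, _ => False

/-- A tail that can follow the arrow `a` and the Fermionic vertices in `S`. -/
def Core.Follows (a : Arrow E) (S : Finset V) : Core V E → Prop
  | .nil => G.arng a ∉ G.bos → S = ∅
  | .bos _ => False
  | .cons b _ _ => G.arng a ∈ G.bos ∧ G.arng a = G.asrc b ∧ (S = ∅ → ¬ Clash γ a b)

/-- The tail consists of successively compatible pieces. -/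
def Core.Valid : Core V E → Prop
  | .nil => True
  | .bos v => v ∈ G.bos
  | .cons a S c => c.Valid ∧ (∀ w ∈ S, w ∉ G.bos) ∧ c.Follows γ a S

/-- Fermionic vertices can be put before the tail. -/
def Core.Prefixable (G : SuperGraph V E) : Core V E → Prop
  | .cons a _ _ => G.asrc a ∈ G.bos
  | _ => True

/-- The pair `(S, c)` encodes a normal form. -/
def IsForm (r : Finset V × Core V E) : Prop :=
  r.2.Valid γ ∧ (∀ w ∈ r.1, w ∉ G.bos) ∧ (r.2.Prefixable G ∨ r.1 = ∅)

/-- The free module on the normal forms. -/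
abbrev FormModule (K : Type*) [Field K] : Type _ := {r : Finset V × Core V E // IsForm γ r} →₀ K

variable (K : Type*) [Field K]

/-- The basis vector of a normal form, and `0` for any other pair. -/
noncomputable def form (r : Finset V × Core V E) : FormModule γ K :=
  if h : IsForm γ r then Finsupp.single ⟨r, h⟩ 1 else 0

variable {γ} in
theorem form_of_isForm {r : Finset V × Core V E} (h : IsForm γ r) :
    form γ K r = Finsupp.single ⟨r, h⟩ 1 := dif_pos h

variable {γ} in
theorem form_of_not_isForm {r : Finset V × Core V E} (h : ¬ IsForm γ r) : form γ K r = 0 :=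
  dif_neg h

variable (G) in
/-- The Bosonic edges leaving `v`, if there are finitely many. -/
noncomputable def bosOut (v : V) : Finset E :=
  if h : {e | G.src e = v ∧ G.rng e ∈ G.bos}.Finite then h.toFinset else ∅

theorem mem_bosOut {v : V} (hv : v ∈ G.regBos) (e : E) :
    e ∈ bosOut G v ↔ G.src e = v ∧ G.rng e ∈ G.bos := by
  have h : {e | G.src e = v ∧ G.rng e ∈ G.bos}.Finite := hv.2.2.subset fun e he => he.1
  simp [bosOut, h]

variable {γ} in
theorem SpecialEdges.IsSpecial.regBos {e : E} (he : γ.IsSpecial e) : G.src e ∈ G.regBos := by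
  obtain ⟨v, rfl⟩ := he
  rw [γ.src_edge]
  exact v.2

variable {γ} in
theorem SpecialEdges.IsSpecial.rng {e : E} (he : γ.IsSpecial e) : G.rng e ∈ G.bos := by
  obtain ⟨v, rfl⟩ := he
  exact γ.rng_edge v

variable {γ} in
theorem SpecialEdges.IsSpecial.isBosonicEdge {e : E} (he : γ.IsSpecial e) : G.IsBosonicEdge e :=
  ⟨he.regBos.1, he.rng⟩

variable {γ} in
theorem SpecialEdges.IsSpecial.eq_of_src {e f : E} (he : γ.IsSpecial e) (hf : γ.IsSpecial f)
    (h : G.src e = G.src f) : e = f := by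
  obtain ⟨v, rfl⟩ := he
  obtain ⟨u, rfl⟩ := hf
  rw [γ.src_edge, γ.src_edge] at h
  rw [Subtype.ext h]

variable {γ K} in
theorem end_ext {f g : Module.End K (FormModule γ K)}
    (h : ∀ r, IsForm γ r → f (form γ K r) = g (form γ K r)) : f = g := by
  refine Finsupp.lhom_ext' fun r => LinearMap.ext_ring ?_
  simpa [form_of_isForm K r.2] using h r.1 r.2

/-- The span of the non-empty normal forms. -/
noncomputable def augmentation : Submodule K (FormModule γ K) :=
  Submodule.span K {n | ∃ r, IsForm γ r ∧ r ≠ (∅, .nil) ∧ form γ K r = n}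

variable {γ K} in
theorem form_mem_augmentation {r : Finset V × Core V E} (hr : r ≠ (∅, .nil)) :
    form γ K r ∈ augmentation γ K := by
  by_cases h : IsForm γ r
  · exact Submodule.subset_span ⟨r, h, hr, rfl⟩
  · rw [form_of_not_isForm K h]
    exact zero_mem _

/-! ### Left action of the generators on normal forms -/

variable [LinearOrder V]

/-- Left multiplication of a normal form by the Bosonic vertex `v`. -/
noncomputable def bosAct (v : V) : Finset V × Core V E → FormModule γ K
  | (S, .nil) => form γ K (S, .bos v)
  | (S, .bos v') => if v = v' then form γ K (S, .bos v') else 0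
  | (S, .cons a T c) => if v = G.asrc a then form γ K (S, .cons a T c) else 0

/-- The value of `a b T c` if the product `a b` is rewritten. -/
noncomputable def clashAct : Arrow E → Arrow E → Finset V → Core V E → FormModule γ K
  | .ghost e, .real e', T, c =>
      if e = e' ∧ G.IsBosonicEdge e then bosAct γ K (G.rng e) (T, c) else 0
  | .real e, .ghost _, T, c =>
      bosAct γ K (G.src e) (T, c) -
        ∑ f ∈ (bosOut G (G.src e)).erase e,
          form γ K (∅, .cons (.real f) ∅ (.cons (.ghost f) T c))
  | _, _, _, _ => 0

/-- Left multiplication of a normal form by the arrow `a`. -/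
noncomputable def arrAct (a : Arrow E) : Finset V × Core V E → FormModule γ K
  | (S, .nil) => form γ K (∅, .cons a S .nil)
  | (S, .bos v) => if v = G.arng a then form γ K (∅, .cons a S .nil) else 0
  | (S, .cons b T c) =>
      if S = ∅ ∧ Clash γ a b then clashAct γ K a b T c else form γ K (∅, .cons a S (.cons b T c))

/-- Left multiplication of a normal form by the Fermionic vertex `w`. -/
noncomputable def ferAct (w : V) (r : Finset V × Core V E) : FormModule γ K :=
  if w ∈ r.1 then 0 else (-1 : K) ^ (r.1.filter (· < w)).card • form γ K (insert w r.1, r.2)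

/-- Left multiplication of a normal form by a generator. -/
noncomputable def letterAct : Letter V E → Finset V × Core V E → FormModule γ K
  | .vert v, r => if v ∈ G.bos then bosAct γ K v r else ferAct γ K v r
  | .arr a, r => arrAct γ K a r

/-- Left multiplication by a generator on the module of normal forms. -/
noncomputable def letterOp (x : Letter V E) : Module.End K (FormModule γ K) :=
  Finsupp.linearCombination K fun r => letterAct γ K x r.1

variable {γ K}

theorem letterOp_form (x : Letter V E) {r : Finset V × Core V E} (h : IsForm γ r) :
    letterOp γ K x (form γ K r) = letterAct γ K x r := by
  simp [letterOp, form_of_isForm K h]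

/-- No `IsForm` hypothesis is needed: `bosAct` sends a pair that is not a form to `0`, which agrees
with `form` being `0` there. The analogue for arrows fails, since absorbing an invalid `.bos v` can
produce a genuine form. -/
theorem letterOp_bos {v : V} (hv : v ∈ G.bos) (r : Finset V × Core V E) :
    letterOp γ K (.vert v) (form γ K r) = bosAct γ K v r := by
  by_cases h : IsForm γ r
  · simp [letterOp_form _ h, letterAct, hv]
  · rw [form_of_not_isForm K h, map_zero]
    rcases r with ⟨S, _ | v' | ⟨a, T, c⟩⟩
    · refine (form_of_not_isForm K fun h' => h ?_).symm
      exact ⟨trivial, h'.2.1, .inl trivial⟩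
    · simp [bosAct, form_of_not_isForm K h]
    · simp [bosAct, form_of_not_isForm K h]

theorem letterOp_fer {w : V} (hw : w ∉ G.bos) (r : Finset V × Core V E) :
    letterOp γ K (.vert w) (form γ K r) = ferAct γ K w r := by
  by_cases h : IsForm γ r
  · simp [letterOp_form _ h, letterAct, hw]
  · rw [form_of_not_isForm K h, map_zero, ferAct]
    rw [form_of_not_isForm K (r := (insert w r.1, r.2)), smul_zero, ite_self]
    rintro ⟨h1, h2, h3⟩
    refine h ⟨h1, fun w' hw' => h2 w' (Finset.mem_insert_of_mem hw'), .inl ?_⟩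
    simpa using h3

theorem letterOp_bos_bosAct {v v' : V} (hv : v ∈ G.bos) (r : Finset V × Core V E) :
    letterOp γ K (.vert v) (bosAct γ K v' r) = if v = v' then bosAct γ K v' r else 0 := by
  rcases r with ⟨S, _ | u | ⟨a, T, c⟩⟩
  · simp [bosAct, letterOp_bos hv]
  · by_cases h : v' = u
    · subst h; simp [bosAct, letterOp_bos hv]
    · simp [bosAct, h]
  · by_cases h : v' = G.asrc a
    · subst h; simp [bosAct, letterOp_bos hv]
    · simp [bosAct, h]

/-- The sign counts the elements jumped over when sorting. For `w < w'`, inserting `w` first adds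
one element below `w'`, while inserting `w'` first adds none below `w`; the two signs differ by
`-1`. -/
theorem letterOp_fer_ferAct {w w' : V} (hw : w ∉ G.bos) (hw' : w' ∉ G.bos)
    (r : Finset V × Core V E) :
    letterOp γ K (.vert w) (ferAct γ K w' r) = -letterOp γ K (.vert w') (ferAct γ K w r) := by
  wlog hlt : w < w' generalizing w w'
  · rcases eq_or_lt_of_not_gt hlt with h | h
    · subst h
      by_cases hS : w' ∈ r.1
      · simp [ferAct, hS]
      · simp [ferAct, hS, letterOp_fer hw]
    · rw [this hw' hw h, neg_neg]
  obtain ⟨S, c⟩ := r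
  by_cases h : w ∈ S
  · by_cases h' : w' ∈ S <;> simp [ferAct, h, h', letterOp_fer hw]
  by_cases h' : w' ∈ S
  · simp [ferAct, h, h', letterOp_fer hw']
  have e1 : (insert w' S).filter (· < w) = S.filter (· < w) := by
    rw [Finset.filter_insert, if_neg hlt.not_gt]
  have e2 : ((insert w S).filter (· < w')).card = (S.filter (· < w')).card + 1 := by
    rw [Finset.filter_insert, if_pos hlt, Finset.card_insert_of_notMem (by simp [h])]
  simp only [ferAct, h, h', if_false, map_smul, letterOp_fer hw, letterOp_fer hw',
    Finset.mem_insert, hlt.ne, hlt.ne', or_self, e1, e2, Finset.insert_comm w w', smul_smul]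
  rw [← neg_smul]
  congr 1
  ring

theorem letterOp_bos_ferAct {v w : V} (hv : v ∈ G.bos) (hw : w ∉ G.bos)
    (r : Finset V × Core V E) :
    letterOp γ K (.vert v) (ferAct γ K w r) = letterOp γ K (.vert w) (bosAct γ K v r) := by
  obtain ⟨S, c⟩ := r
  have key : ∀ c' : Core V E, letterOp γ K (.vert w) (form γ K (S, c')) =
      if w ∈ S then 0 else (-1 : K) ^ (S.filter (· < w)).card • form γ K (insert w S, c') :=
    fun c' => letterOp_fer hw _
  by_cases h : w ∈ S
  · rcases c with _ | u | ⟨a, T, c⟩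
    · simp [ferAct, bosAct, h, key]
    · by_cases h' : v = u <;> simp [ferAct, bosAct, h, h', key]
    · by_cases h' : v = G.asrc a <;> simp [ferAct, bosAct, h, h', key]
  · rcases c with _ | u | ⟨a, T, c⟩
    · simp [ferAct, bosAct, h, key, letterOp_bos hv]
    · by_cases h' : v = u <;> simp [ferAct, bosAct, h, h', key, letterOp_bos hv]
      simp [← h', letterOp_bos hv, bosAct]
    · by_cases h' : v = G.asrc a <;> simp [ferAct, bosAct, h, h', key, letterOp_bos hv]
      simp [← h', letterOp_bos hv, bosAct]

theorem letterOp_bos_arrAct {v : V} (hv : v ∈ G.bos) (a : Arrow E) (r : Finset V × Core V E) :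
    letterOp γ K (.vert v) (arrAct γ K a r) = if v = G.asrc a then arrAct γ K a r else 0 := by
  have key : ∀ (S : Finset V) (c : Core V E), letterOp γ K (.vert v) (form γ K (∅, .cons a S c)) =
      if v = G.asrc a then form γ K (∅, .cons a S c) else 0 := fun S c => letterOp_bos hv _
  rcases r with ⟨S, _ | u | ⟨b, T, c⟩⟩
  · exact key _ _
  · by_cases h : u = G.arng a
    · simp only [arrAct, h, if_true, key]
    · simp [arrAct, h]
  · by_cases h : S = ∅ ∧ Clash γ a b
    · simp only [arrAct, if_pos h]
      rcases a with e | e <;> rcases b with f | f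
      · simp [clashAct]
      · obtain ⟨-, rfl, he⟩ := h
        simp only [clashAct, map_sub, map_sum, letterOp_bos_bosAct hv]
        -- All terms of the expansion of `e e*` start at the same vertex, so `v` fixes all of them
        -- or kills all of them.
        have : ∀ f ∈ (bosOut G (G.src e)).erase e, letterOp γ K (.vert v)
            (form γ K (∅, .cons (.real f) ∅ (.cons (.ghost f) T c))) = if v = G.src e then
            form γ K (∅, .cons (.real f) ∅ (.cons (.ghost f) T c)) else 0 := by
          intro f hf
          have hs : G.asrc (.real f) = G.src e :=
            ((mem_bosOut he.regBos f).1 (Finset.mem_of_mem_erase hf)).1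
          simp only [letterOp_bos hv, bosAct, hs]
        rw [Finset.sum_congr rfl this]
        by_cases h' : v = G.src e <;> simp [h', SuperGraph.asrc]
      · by_cases h' : e = f ∧ G.IsBosonicEdge e
        · simp only [clashAct, if_pos h', letterOp_bos_bosAct hv, SuperGraph.asrc]
        · simp [clashAct, h']
      · simp [clashAct]
    · simp only [arrAct, if_neg h, key]

/-- A Bosonic vertex differs from `s(a)`, a Fermionic one violates `Prefixable`, and an arrow
violates `Follows`. The only possible clash is `e* e` with `e` not Bosonic, whose value is `0`. -/
theorem letterOp_cons_of_asrc_fer {a : Arrow E} (ha : G.asrc a ∉ G.bos) (y : Letter V E)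
    (S : Finset V) (c : Core V E) :
    letterOp γ K y (form γ K (∅, .cons a S c)) = 0 := by
  by_cases h : IsForm γ (∅, .cons a S c)
  · rw [letterOp_form _ h]
    rcases y with v | b
    · by_cases hv : v ∈ G.bos
      · have : v ≠ G.asrc a := fun h => ha (h ▸ hv)
        simp [letterAct, hv, bosAct, this]
      · simp only [letterAct, hv, if_false, ferAct]
        rw [form_of_not_isForm]
        · simp
        · rintro ⟨-, -, h | h⟩
          · exact ha h
          · simp at h
    · simp only [letterAct, arrAct]
      have key : form γ K (∅, .cons b ∅ (.cons a S c)) = 0 := by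
        refine form_of_not_isForm K ?_
        rintro ⟨⟨-, -, h1, h2, -⟩, -⟩
        exact ha (h2 ▸ h1)
      split_ifs with hc
      · rcases b with e | e <;> rcases a with f | f
        · exact hc.2.elim
        · obtain ⟨-, rfl, he⟩ := hc
          exact (ha he.rng).elim
        · simp only [clashAct]
          rw [if_neg]
          rintro ⟨rfl, h2⟩
          exact ha h2.1
        · exact hc.2.elim
      · exact key
  · rw [form_of_not_isForm K h, map_zero]

theorem letterOp_arrAct_of_asrc_fer {a : Arrow E} (ha : G.asrc a ∉ G.bos) (y : Letter V E)
    (r : Finset V × Core V E) :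
    letterOp γ K y (arrAct γ K a r) = 0 := by
  rcases r with ⟨S, _ | u | ⟨b, T, c⟩⟩
  · exact letterOp_cons_of_asrc_fer ha _ _ _
  · simp only [arrAct]
    split_ifs
    · exact letterOp_cons_of_asrc_fer ha _ _ _
    · exact map_zero _
  · simp only [arrAct]
    split_ifs with hc
    · rcases a with e | e <;> rcases b with f | f
      · exact hc.2.elim
      · obtain ⟨-, rfl, he⟩ := hc
        exact (ha he.regBos.1).elim
      · simp only [clashAct]
        rw [if_neg, map_zero]
        rintro ⟨rfl, h2⟩
        exact ha h2.2
      · exact hc.2.elim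
    · exact letterOp_cons_of_asrc_fer ha _ _ _

/-- The empty form must be excluded, because `a` sends it to the form of `a` itself. The exception
is harmless for products `a y`: any letter `y` maps into `augmentation`. -/
theorem letterOp_arr_form_of_arng_fer {a : Arrow E} (ha : G.arng a ∉ G.bos)
    {r : Finset V × Core V E} (hr : r ≠ (∅, .nil)) :
    letterOp γ K (.arr a) (form γ K r) = 0 := by
  by_cases h : IsForm γ r
  · rw [letterOp_form _ h]
    rcases r with ⟨S, _ | u | ⟨b, T, c⟩⟩
    · simp only [letterAct, arrAct]
      refine form_of_not_isForm K ?_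
      rintro ⟨⟨-, -, h1⟩, -⟩
      exact hr (by rw [h1 ha])
    · simp only [letterAct, arrAct]
      rw [if_neg]
      rintro rfl
      exact ha h.1
    · simp only [letterAct, arrAct]
      split_ifs with hc
      · rcases a with e | e <;> rcases b with f | f
        · exact hc.2.elim
        · obtain ⟨-, rfl, he⟩ := hc
          exact (ha he.rng).elim
        · simp only [clashAct]
          rw [if_neg]
          rintro ⟨rfl, h2⟩
          exact ha h2.1
        · exact hc.2.elim
      · refine form_of_not_isForm K ?_
        rintro ⟨⟨-, -, h1, -⟩, -⟩
        exact ha h1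
  · rw [form_of_not_isForm K h, map_zero]

theorem bosAct_mem_augmentation (v : V) (r : Finset V × Core V E) :
    bosAct γ K v r ∈ augmentation γ K := by
  rcases r with ⟨S, _ | u | ⟨a, T, c⟩⟩ <;> simp only [bosAct]
  · exact form_mem_augmentation (by simp)
  · split_ifs
    exacts [form_mem_augmentation (by simp), zero_mem _]
  · split_ifs
    exacts [form_mem_augmentation (by simp), zero_mem _]

theorem letterAct_mem_augmentation (x : Letter V E) (r : Finset V × Core V E) :
    letterAct γ K x r ∈ augmentation γ K := by
  rcases x with v | a
  · simp only [letterAct]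
    split_ifs
    · exact bosAct_mem_augmentation _ _
    · rw [ferAct]
      split_ifs
      exacts [zero_mem _, Submodule.smul_mem _ _ (form_mem_augmentation (by simp))]
  · simp only [letterAct]
    rcases r with ⟨S, _ | u | ⟨b, T, c⟩⟩ <;> simp only [arrAct]
    · exact form_mem_augmentation (by simp)
    · split_ifs
      exacts [form_mem_augmentation (by simp), zero_mem _]
    · split_ifs
      · rcases a with e | e <;> rcases b with f | f <;> simp only [clashAct]
        · exact zero_mem _
        · exact sub_mem (bosAct_mem_augmentation _ _)
            (Submodule.sum_mem _ fun f _ => form_mem_augmentation (by simp))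
        · split_ifs
          exacts [bosAct_mem_augmentation _ _, zero_mem _]
        · exact zero_mem _
      · exact form_mem_augmentation (by simp)

theorem letterOp_mem_augmentation (x : Letter V E) (n : FormModule γ K) :
    letterOp γ K x n ∈ augmentation γ K := by
  rw [letterOp, Finsupp.linearCombination_apply]
  exact Submodule.sum_mem _ fun r _ => Submodule.smul_mem _ _ (letterAct_mem_augmentation x r.1)

theorem letterOp_arr_of_arng_fer {a : Arrow E} (ha : G.arng a ∉ G.bos) (y : Letter V E)
    (n : FormModule γ K) : letterOp γ K (.arr a) (letterOp γ K y n) = 0 := by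
  have h : augmentation γ K ≤ LinearMap.ker (letterOp γ K (.arr a)) := by
    refine Submodule.span_le.2 ?_
    rintro _ ⟨r, -, hr, rfl⟩
    exact letterOp_arr_form_of_arng_fer ha hr
  exact h (letterOp_mem_augmentation y n)

/-- Associativity of `a v r`. When `r` starts with an arrow `b` after its Fermionic block, the point
is that `a` kills `r` unless `r(a) = s(b)`: otherwise the concatenation is not a form, and a clash
of nonzero value is always composable. -/
theorem letterOp_arr_bosAct {v : V} (hv : v ∈ G.bos) (a : Arrow E) {r : Finset V × Core V E}
    (hr : IsForm γ r) :
    letterOp γ K (.arr a) (bosAct γ K v r) = if v = G.arng a then arrAct γ K a r else 0 := by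
  rcases r with ⟨S, _ | u | ⟨b, T, c⟩⟩
  · have : IsForm γ (S, .bos v) := ⟨hv, hr.2.1, .inl trivial⟩
    simp only [bosAct, letterOp_form _ this, letterAct, arrAct]
  · by_cases h : v = u
    · subst h
      simp only [bosAct, if_true, letterOp_form _ hr, letterAct, arrAct]
      split_ifs <;> rfl
    · by_cases h' : v = G.arng a
      · have : u ≠ G.arng a := fun h'' => h (h'.trans h''.symm)
        simp [bosAct, h, arrAct, this]
      · simp [bosAct, h, h']
  · have key : G.arng a ≠ G.asrc b → arrAct γ K a (S, .cons b T c) = 0 := by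
      intro hab
      simp only [arrAct]
      split_ifs with hc
      · rcases a with e | e <;> rcases b with f | f
        · exact hc.2.elim
        · obtain ⟨-, rfl, he⟩ := hc
          exact (hab rfl).elim
        · simp only [clashAct]
          rw [if_neg]
          rintro ⟨rfl, h2⟩
          exact hab rfl
        · exact hc.2.elim
      · refine form_of_not_isForm K ?_
        rintro ⟨⟨-, -, -, h1, -⟩, -⟩
        exact hab h1
    by_cases h : v = G.asrc b
    · simp only [bosAct, if_pos h, letterOp_form _ hr, letterAct]
      split_ifs with h'
      · rfl
      · exact key fun h'' => h' (h.trans h''.symm)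
    · simp only [bosAct, if_neg h, map_zero]
      split_ifs with h'
      · exact (key fun h'' => h (h'.trans h'')).symm
      · rfl

end NormalForms

/-! ### The defining relations hold for the operators -/

section Representation

variable {V E : Type*} {G : SuperGraph V E} {γ : SpecialEdges G} {K : Type*} [Field K]
  [LinearOrder V]

theorem letterOp_src_bos {v : V} (hv : v ∈ G.bos) (a : Arrow E) :
    letterOp γ K (.vert v) * letterOp γ K (.arr a) =
      if v = G.asrc a then letterOp γ K (.arr a) else 0 := by
  refine end_ext fun r hr => ?_
  rw [Module.End.mul_apply, letterOp_form _ hr, letterAct, letterOp_bos_arrAct hv]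
  split_ifs
  · rw [letterOp_form _ hr, letterAct]
  · rfl

theorem letterOp_rng_bos {v : V} (hv : v ∈ G.bos) (a : Arrow E) :
    letterOp γ K (.arr a) * letterOp γ K (.vert v) =
      if v = G.arng a then letterOp γ K (.arr a) else 0 := by
  refine end_ext fun r hr => ?_
  rw [Module.End.mul_apply, letterOp_bos hv, letterOp_arr_bosAct hv _ hr]
  split_ifs
  · rw [letterOp_form _ hr, letterAct]
  · rfl

theorem letterOp_src_fer {a : Arrow E} (ha : G.asrc a ∉ G.bos) (y : Letter V E) :
    letterOp γ K y * letterOp γ K (.arr a) = 0 := by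
  refine end_ext fun r hr => ?_
  rw [Module.End.mul_apply, letterOp_form _ hr, letterAct, letterOp_arrAct_of_asrc_fer ha]
  rfl

theorem letterOp_rng_fer {a : Arrow E} (ha : G.arng a ∉ G.bos) (y : Letter V E) :
    letterOp γ K (.arr a) * letterOp γ K y = 0 :=
  LinearMap.ext fun n => letterOp_arr_of_arng_fer ha y n

theorem letterOp_bos_mul_bos {v v' : V} (hv : v ∈ G.bos) (hv' : v' ∈ G.bos) :
    letterOp γ K (.vert v) * letterOp γ K (.vert v') =
      if v = v' then letterOp γ K (.vert v') else 0 := by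
  refine end_ext fun r hr => ?_
  rw [Module.End.mul_apply, letterOp_bos hv', letterOp_bos_bosAct hv]
  split_ifs
  · rw [letterOp_bos hv']
  · rfl

theorem letterOp_fer_mul_fer {w w' : V} (hw : w ∉ G.bos) (hw' : w' ∉ G.bos) :
    letterOp γ K (.vert w) * letterOp γ K (.vert w') =
      -(letterOp γ K (.vert w') * letterOp γ K (.vert w)) := by
  refine end_ext fun r hr => ?_
  rw [LinearMap.neg_apply, Module.End.mul_apply, Module.End.mul_apply, letterOp_fer hw,
    letterOp_fer hw', letterOp_fer_ferAct hw hw']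

theorem letterOp_bos_mul_fer {v w : V} (hv : v ∈ G.bos) (hw : w ∉ G.bos) :
    letterOp γ K (.vert v) * letterOp γ K (.vert w) =
      letterOp γ K (.vert w) * letterOp γ K (.vert v) := by
  refine end_ext fun r hr => ?_
  rw [Module.End.mul_apply, Module.End.mul_apply, letterOp_fer hw, letterOp_bos hv,
    letterOp_bos_ferAct hv hw]


omit [LinearOrder V] in
theorem IsForm.tail {S T : Finset V} {a : Arrow E} {c : Core V E}
    (h : IsForm γ (S, .cons a T c)) : IsForm γ (T, c) := by
  obtain ⟨⟨h1, h2, h3⟩, -⟩ := h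
  refine ⟨h1, h2, .inl ?_⟩
  rcases c with _ | u | ⟨b, T', c⟩
  · trivial
  · trivial
  · exact (congrArg (· ∈ G.bos) h3.2.1).mp h3.1

theorem arrAct_of_isForm {T : Finset V} {a : Arrow E} {c : Core V E}
    (h : IsForm γ (∅, .cons a T c)) : arrAct γ K a (T, c) = form γ K (∅, .cons a T c) := by
  rcases c with _ | u | ⟨b, T', c⟩
  · rfl
  · exact h.1.2.2.elim
  · rw [arrAct, if_neg]
    rintro ⟨h1, h2⟩
    exact h.1.2.2.2.2 h1 h2

-- A leading ghost `f*` is constrained only by its range `s(f)` and by its clashes. Since `Clash`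
-- treats all pairs of Bosonic edges alike, `f*` can be exchanged for `e*` when `e` and `f` are
-- Bosonic with the same source.
omit [LinearOrder V] in
theorem IsForm.ghost_of_special {e f : E} {T : Finset V} {c : Core V E}
    (h : IsForm γ (∅, .cons (.ghost f) T c)) (hf : G.IsBosonicEdge f) (he : G.IsBosonicEdge e)
    (hef : G.src e = G.src f) : IsForm γ (∅, .cons (.ghost e) T c) := by
  obtain ⟨⟨h1, h2, h3⟩, -⟩ := h
  refine ⟨⟨h1, h2, ?_⟩, by simp, .inr rfl⟩
  rcases c with _ | u | ⟨b, T', c⟩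
  · exact fun h => (h he.1).elim
  · exact h3.elim
  · obtain ⟨h4, h5, h6⟩ := h3
    refine ⟨he.1, hef.trans h5, fun hT hc => h6 hT ?_⟩
    rcases b with g | g
    · rcases hc with rfl | hc
      · exact .inr ⟨hf, he⟩
      · exact .inr ⟨hf, hc.2⟩
    · exact hc.elim

omit [LinearOrder V] in
theorem IsForm.real_ghost {e : E} {T : Finset V} {c : Core V E}
    (h : IsForm γ (∅, .cons (.ghost e) T c)) (he : G.IsBosonicEdge e) (hs : ¬ γ.IsSpecial e) :
    IsForm γ (∅, .cons (.real e) ∅ (.cons (.ghost e) T c)) :=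
  ⟨⟨h.1, by simp, he.2, rfl, fun _ hc => hs hc.2⟩, by simp, .inr rfl⟩

theorem letterOp_ghost_cons_real {e f : E} (he : G.IsBosonicEdge e) (hf : G.IsBosonicEdge f)
    {S : Finset V} {c : Core V E} (h : IsForm γ (∅, .cons (.real f) S c)) :
    letterOp γ K (.arr (.ghost e)) (form γ K (∅, .cons (.real f) S c)) =
      if e = f then bosAct γ K (G.rng e) (S, c) else 0 := by
  rw [letterOp_form _ h, letterAct, arrAct, if_pos ⟨rfl, .inr ⟨he, hf⟩⟩, clashAct]
  simp only [he, and_true]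

/-- The critical case is a form beginning with `f*` where `f` is special: there `f f*` expands as `v
- ∑ g g*`, and the effect of `e*` must be computed term by term. -/
theorem letterOp_ghost_mul_real {e f : E} (he : G.IsBosonicEdge e) (hf : G.IsBosonicEdge f) :
    letterOp γ K (.arr (.ghost e)) * letterOp γ K (.arr (.real f)) =
      if e = f then letterOp γ K (.vert (G.rng e)) else 0 := by
  refine end_ext fun r hr => ?_
  have hR : (if e = f then letterOp γ K (.vert (G.rng e)) else 0) (form γ K r) =
      if e = f then bosAct γ K (G.rng e) r else 0 := by
    split_ifs
    · rw [letterOp_bos he.2]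
    · rfl
  rw [Module.End.mul_apply, letterOp_form _ hr, letterAct, hR]
  have hnil : ∀ {S : Finset V}, (∀ w ∈ S, w ∉ G.bos) → IsForm γ (∅, .cons (.real f) S .nil) :=
    fun hS => ⟨⟨trivial, hS, fun h => (h hf.2).elim⟩, by simp, .inr rfl⟩
  rcases r with ⟨S, _ | u | ⟨b, T, c⟩⟩
  · exact letterOp_ghost_cons_real he hf (hnil hr.2.1)
  · rw [arrAct]
    have h0 : G.arng (.real f) = G.rng f := rfl
    simp only [h0]
    by_cases hu : u = G.rng f
    · rw [if_pos hu, letterOp_ghost_cons_real he hf (hnil hr.2.1)]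
      split_ifs with hef
      · subst hef hu
        simp [bosAct]
      · rfl
    · rw [if_neg hu, map_zero]
      split_ifs with hef
      · subst hef
        rw [bosAct, if_neg (Ne.symm hu)]
      · rfl
  · rw [arrAct]
    split_ifs with hc hef hef
    -- Here `e = f` is special. Each `g` in the sum differs from `e`, so `e* g` contributes nothing;
    -- what remains is `e* v = e*`, the original form.
    · obtain ⟨rfl, hc⟩ := hc
      subst hef
      rcases b with g | g
      · exact hc.elim
      obtain ⟨rfl, hs⟩ := hc
      rw [clashAct, map_sub, letterOp_arr_bosAct he.1 _ hr.tail, map_sum,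
        Finset.sum_eq_zero, sub_zero, if_pos (show G.src e = G.arng (.ghost e) from rfl),
        arrAct_of_isForm hr, bosAct, if_pos (show G.rng e = G.asrc (.ghost e) from rfl)]
      intro g hg
      rw [Finset.mem_erase, mem_bosOut hs.regBos] at hg
      have hg' : G.IsBosonicEdge g := ⟨hg.2.1 ▸ he.1, hg.2.2⟩
      rw [letterOp_ghost_cons_real he hg', if_neg hg.1.symm]
      exact (hr.ghost_of_special he hg' hg.2.1).real_ghost hg'
        fun h => hg.1 (h.eq_of_src hs hg.2.1)
    -- Here `e ≠ f`. If `s(e) = s(f)`, the single surviving term `g = e` of the sum cancels `e* v =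
    -- e*`; otherwise both contributions vanish.
    · obtain ⟨rfl, hc⟩ := hc
      rcases b with g | g
      · exact hc.elim
      obtain ⟨rfl, hs⟩ := hc
      have key : ∀ g ∈ (bosOut G (G.src f)).erase f, letterOp γ K (.arr (.ghost e))
          (form γ K (∅, .cons (.real g) ∅ (.cons (.ghost g) T c))) =
          if e = g then form γ K (∅, .cons (.ghost e) T c) else 0 := by
        intro g hg
        rw [Finset.mem_erase, mem_bosOut hs.regBos] at hg
        have hg' : G.IsBosonicEdge g := ⟨hg.2.1 ▸ hf.1, hg.2.2⟩
        rw [letterOp_ghost_cons_real he hg']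
        · split_ifs with h
          · subst h
            rw [bosAct, if_pos (show G.rng e = G.asrc (.ghost e) from rfl)]
          · rfl
        · exact (hr.ghost_of_special hf hg' hg.2.1).real_ghost hg'
            fun h => hg.1 (h.eq_of_src hs hg.2.1)
      rw [clashAct, map_sub, letterOp_arr_bosAct hf.1 _ hr.tail, map_sum,
        Finset.sum_congr rfl key, Finset.sum_ite_eq]
      have hmem : e ∈ (bosOut G (G.src f)).erase f ↔ G.src f = G.arng (.ghost e) := by
        rw [Finset.mem_erase, mem_bosOut hs.regBos]
        exact ⟨fun h => h.2.1.symm, fun h => ⟨hef, h.symm, he.2⟩⟩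
      by_cases h : G.src f = G.arng (.ghost e)
      · rw [if_pos h, if_pos (hmem.2 h), arrAct_of_isForm, sub_self]
        exact hr.ghost_of_special hf he h.symm
      · rw [if_neg h, if_neg (fun h' => h (hmem.1 h')), sub_self]
    -- Without a clash, `f` is simply prepended, or the product is `0` because the arrows are not
    -- composable.
    all_goals
      by_cases hb : G.rng f = G.asrc b
      · have : IsForm γ (∅, .cons (.real f) S (.cons b T c)) :=
          ⟨⟨hr.1, hr.2.1, hf.2, hb, fun h1 h2 => hc ⟨h1, h2⟩⟩, by simp, .inr rfl⟩
        rw [letterOp_ghost_cons_real he hf this]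
        simp [hef]
      · have : ¬ IsForm γ (∅, .cons (.real f) S (.cons b T c)) := fun h => hb h.1.2.2.2.1
        rw [form_of_not_isForm K this, map_zero]
        all_goals rw [bosAct, if_neg (hef ▸ hb)]

/-- If `s(e)` is Fermionic, `e` is killed from the left. Otherwise `r(e)` is Fermionic and `e`
already kills every form but the empty one, where `e* e` is a clash of value `0`. -/
theorem letterOp_ghost_mul_self_of_not_bosonic {e : E} (he : ¬ G.IsBosonicEdge e) :
    letterOp γ K (.arr (.ghost e)) * letterOp γ K (.arr (.real e)) = 0 := by
  by_cases hs : G.src e ∈ G.bos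
  · have hr : G.rng e ∉ G.bos := fun h => he ⟨hs, h⟩
    refine end_ext fun r h => ?_
    rw [Module.End.mul_apply]
    by_cases h0 : r = (∅, .nil)
    · subst h0
      have : IsForm γ (∅, .cons (.real e) (∅ : Finset V) .nil) :=
        ⟨⟨trivial, by simp, fun _ => rfl⟩, by simp, .inr rfl⟩
      rw [letterOp_form _ h, letterAct, arrAct, letterOp_form _ this, letterAct, arrAct,
        if_pos ⟨rfl, .inl rfl⟩, clashAct, if_neg fun h => he h.2]
      rfl
    · rw [letterOp_arr_form_of_arng_fer (a := .real e) hr h0, map_zero]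
      rfl
  · exact letterOp_src_fer (a := .real e) hs _

/-- The special edge contributes `v` minus precisely the terms that the other edges contribute
unreduced. -/
theorem sum_letterOp_real_ghost {v : V} (hv : v ∈ G.regBos) {T : Finset V} {c : Core V E}
    (h : ∀ f ∈ bosOut G v, IsForm γ (∅, .cons (.ghost f) T c)) :
    ∑ f ∈ bosOut G v, letterOp γ K (.arr (.real f)) (form γ K (∅, .cons (.ghost f) T c)) =
      bosAct γ K v (T, c) := by
  set g := γ.edge ⟨v, hv⟩ with hg
  have hgs : γ.IsSpecial g := ⟨_, rfl⟩
  have hgv : G.src g = v := γ.src_edge _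
  have hgm : g ∈ bosOut G v := (mem_bosOut hv g).2 ⟨hgv, γ.rng_edge _⟩
  rw [← Finset.add_sum_erase _ _ hgm, letterOp_form _ (h g hgm), letterAct, arrAct,
    if_pos ⟨rfl, rfl, hgs⟩, clashAct, hgv, Finset.sum_congr rfl, sub_add_cancel]
  intro f hf
  rw [Finset.mem_erase] at hf
  rw [letterOp_form _ (h f hf.2), letterAct, arrAct, if_neg]
  rintro ⟨-, -, hfs⟩
  exact hf.1 (hfs.eq_of_src hgs (((mem_bosOut hv f).1 hf.2).1.trans hgv.symm))

theorem letterOp_regular {v : V} (hv : v ∈ G.regBos) :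
    letterOp γ K (.vert v) = ∑ f ∈ bosOut G v,
      letterOp γ K (.arr (.real f)) * letterOp γ K (.arr (.ghost f)) := by
  refine end_ext fun r hr => ?_
  simp only [LinearMap.sum_apply, Module.End.mul_apply, letterOp_bos hv.1, letterOp_form _ hr,
    letterAct]
  have hbos : ∀ f ∈ bosOut G v, G.IsBosonicEdge f := fun f hf =>
    ⟨((mem_bosOut hv f).1 hf).1 ▸ hv.1, ((mem_bosOut hv f).1 hf).2⟩
  have hrng : ∀ f ∈ bosOut G v, v = G.arng (.ghost f) := fun f hf =>
    ((mem_bosOut hv f).1 hf).1.symm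
  have hnil : ∀ {S : Finset V}, (∀ w ∈ S, w ∉ G.bos) →
      ∀ f ∈ bosOut G v, IsForm γ (∅, .cons (.ghost f) S .nil) := fun hS f hf =>
    ⟨⟨trivial, hS, fun h => (h (hbos f hf).1).elim⟩, by simp, .inr rfl⟩
  -- Since `f* v = f*` for each `f` in the sum, a form killed by `v` is killed by every `f*`.
  by_cases h0 : bosAct γ K v r = 0
  · rw [h0, Finset.sum_eq_zero]
    intro f hf
    have := letterOp_arr_bosAct (K := K) hv.1 (.ghost f) hr
    rw [h0, map_zero, if_pos (hrng f hf)] at this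
    rw [← this, map_zero]
  rcases r with ⟨S, _ | u | ⟨b, T, c⟩⟩
  · exact (sum_letterOp_real_ghost hv (hnil hr.2.1)).symm
  · rw [bosAct] at h0 ⊢
    split_ifs at h0 ⊢ with hu
    · subst hu
      rw [Finset.sum_congr rfl fun f hf => by rw [arrAct, if_pos (hrng f hf)]]
      exact (sum_letterOp_real_ghost hv (hnil hr.2.1)).symm
    · exact (h0 rfl).elim
  · have hb : v = G.asrc b := by
      by_contra h
      exact h0 (if_neg h)
    -- If some `f*` clashes with the leading arrow, this arrow is a Bosonic edge `g` leaving `v`: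
    -- only `f = g` survives, and `g g* g` restores `g`. Otherwise all `f*` are prepended and the
    -- previous lemma applies.
    by_cases hc : S = ∅ ∧ ∃ f ∈ bosOut G v, Clash γ (.ghost f) b
    · obtain ⟨rfl, f, hf, hc⟩ := hc
      rcases b with g | g
      · have hg : G.IsBosonicEdge g := by
          rcases hc with rfl | h
          exacts [hbos _ hf, h.2]
        have hgm : g ∈ bosOut G v := (mem_bosOut hv g).2 ⟨hb.symm, hg.2⟩
        rw [bosAct, if_pos hb, Finset.sum_eq_single g]
        · rw [arrAct, if_pos ⟨rfl, .inl rfl⟩, clashAct, if_pos ⟨rfl, hg⟩,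
            letterOp_arr_bosAct hg.2 _ hr.tail,
            if_pos (show G.rng g = G.arng (.real g) from rfl), arrAct_of_isForm hr]
        · intro f hf hfg
          rw [arrAct, if_pos ⟨rfl, .inr ⟨hbos f hf, hg⟩⟩, clashAct, if_neg fun h => hfg h.1,
            map_zero]
        · exact fun h => (h hgm).elim
      · exact hc.elim
    · have hc' : ∀ f ∈ bosOut G v, ¬ (S = ∅ ∧ Clash γ (.ghost f) b) :=
        fun f hf h => hc ⟨h.1, f, hf, h.2⟩
      rw [Finset.sum_congr rfl fun f hf => by rw [arrAct, if_neg (hc' f hf)],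
        sum_letterOp_real_ghost hv]
      exact fun f hf => ⟨⟨hr.1, hr.2.1, (hbos f hf).1, (hrng f hf).symm.trans hb,
        fun h1 h2 => hc' f hf ⟨h1, h2⟩⟩, by simp, .inr rfl⟩

theorem lift_letterOp_rel {x y : FreeAlgebra K (Letter V E)} (h : Rel K G x y) :
    FreeAlgebra.lift K (letterOp γ K) x = FreeAlgebra.lift K (letterOp γ K) y := by
  induction h with
  | bos_idem v hv => simp [fv, letterOp_bos_mul_bos hv hv]
  | bos_orth v v' hv hv' h => simp [fv, letterOp_bos_mul_bos hv hv', h]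
  | fer_anti w w' hw hw' => simp [fv, letterOp_fer_mul_fer hw hw']
  | bos_fer v w hv hw => simp [fv, letterOp_bos_mul_fer hv hw]
  | src_bos a ha => simp [fv, fa, letterOp_src_bos ha]
  | src_fer a ha => simp [fv, fa, letterOp_src_fer ha]
  | rng_bos a ha => simp [fv, fa, letterOp_rng_bos ha]
  | rng_fer a ha => simp [fv, fa, letterOp_rng_fer ha]
  | ghost_self_bos e he => simp [fv, fa, letterOp_ghost_mul_real he he]
  | ghost_self_fer e he => simp [fa, letterOp_ghost_mul_self_of_not_bosonic he]
  | ghost_ne e e' he he' h => simp [fa, letterOp_ghost_mul_real he he', h]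
  | regular v S hv hS =>
    have : S = bosOut G v := by
      ext e
      rw [hS, mem_bosOut hv]
    simp [fv, fa, letterOp_regular hv, this]
  | mul_arr_arr a b =>
    simp only [fv, fa, map_mul, FreeAlgebra.lift_ι_apply]
    by_cases ha : G.arng a ∈ G.bos
    · by_cases hb : G.asrc b ∈ G.bos
      · rw [← mul_assoc, letterOp_rng_bos ha, if_pos rfl, mul_assoc, letterOp_src_bos hb,
          if_pos rfl]
      · rw [letterOp_src_fer hb, mul_assoc, mul_assoc, letterOp_src_fer hb, mul_zero, mul_zero]
    · rw [letterOp_rng_fer ha, ← mul_assoc, letterOp_rng_fer ha, zero_mul, zero_mul]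
  | mul_vert_arr v a =>
    simp only [fv, fa, map_mul, FreeAlgebra.lift_ι_apply]
    by_cases ha : G.asrc a ∈ G.bos
    · rw [mul_assoc, letterOp_src_bos ha, if_pos rfl]
    · rw [letterOp_src_fer ha, mul_assoc, letterOp_src_fer ha, mul_zero]
  | mul_arr_vert a v =>
    simp only [fv, fa, map_mul, FreeAlgebra.lift_ι_apply]
    by_cases ha : G.arng a ∈ G.bos
    · rw [← mul_assoc, letterOp_rng_bos ha, if_pos rfl]
    · rw [letterOp_rng_fer ha, ← mul_assoc, letterOp_rng_fer ha, zero_mul]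

variable (γ K) in
/-- The representation of the Leavitt path superalgebra on the module of normal forms. -/
noncomputable def formRep : UnitalSL K G →ₐ[K] Module.End K (FormModule γ K) :=
  RingQuot.liftAlgHom K ⟨FreeAlgebra.lift K (letterOp γ K), fun _ _ h => lift_letterOp_rel h⟩

omit [LinearOrder V] in
theorem wordVal_nil : wordVal K G [] = 1 := by simp [wordVal]

omit [LinearOrder V] in
theorem wordVal_cons (x : Letter V E) (u : List (Letter V E)) :
    wordVal K G (x :: u) = wordVal K G [x] * wordVal K G u := by
  simp [wordVal]

omit [LinearOrder V] in
theorem wordVal_append (u u' : List (Letter V E)) :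
    wordVal K G (u ++ u') = wordVal K G u * wordVal K G u' := by
  simp [wordVal]

theorem formRep_singleton (x : Letter V E) :
    formRep γ K (wordVal K G [x]) = letterOp γ K x := by
  simp [formRep, wordVal]

end Representation

/-! ### Identities in the algebra -/

section Evaluation

variable {K : Type*} [Field K] {V E : Type*} {G : SuperGraph V E}

variable (K G) in
/-- The image of a generator in the unital algebra. -/
noncomputable abbrev letterVal (x : Letter V E) : UnitalSL K G := wordVal K G [x]

variable (K G) in
/-- The image of a vertex in the unital algebra. -/
noncomputable abbrev vertVal (v : V) : UnitalSL K G := wordVal K G [.vert v]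

variable (K G) in
/-- The image of an arrow in the unital algebra. -/
noncomputable abbrev arrVal (a : Arrow E) : UnitalSL K G := wordVal K G [.arr a]

theorem mkAlgHom_fv (v : V) : RingQuot.mkAlgHom K (Rel K G) (fv K E v) = vertVal K G v := by
  simp [fv, wordVal]

theorem mkAlgHom_fa (a : Arrow E) : RingQuot.mkAlgHom K (Rel K G) (fa K V a) = arrVal K G a := by
  simp [fa, wordVal]

theorem bos_mul_bos {v v' : V} (hv : v ∈ G.bos) (hv' : v' ∈ G.bos) :
    vertVal K G v * vertVal K G v' = if v = v' then vertVal K G v' else 0 := by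
  split_ifs with h
  · subst h
    simpa [mkAlgHom_fv] using RingQuot.mkAlgHom_rel K (Rel.bos_idem (K := K) v hv)
  · simpa [mkAlgHom_fv] using RingQuot.mkAlgHom_rel K (Rel.bos_orth (K := K) v v' hv hv' h)

theorem fer_mul_fer {w w' : V} (hw : w ∉ G.bos) (hw' : w' ∉ G.bos) :
    vertVal K G w * vertVal K G w' = (-1 : K) • (vertVal K G w' * vertVal K G w) := by
  have h := RingQuot.mkAlgHom_rel K (Rel.fer_anti (K := K) w w' hw hw')
  rw [← neg_one_smul K] at h
  simp only [map_smul, map_mul, mkAlgHom_fv] at h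
  exact h

/-- Anticommutation of `w` with itself only gives `2 w² = 0`; this is where the characteristic
matters. -/
theorem fer_mul_self (hK : ringChar K ≠ 2) {w : V} (hw : w ∉ G.bos) :
    vertVal K G w * vertVal K G w = 0 := by
  have h2 : (2 : K) ≠ 0 := Ring.two_ne_zero hK
  have h : (2 : K) • (vertVal K G w * vertVal K G w) = 0 := by
    have h1 : (0 : K) = -1 + 1 := by norm_num
    rw [two_smul]
    nth_rewrite 1 [fer_mul_fer hw hw]
    nth_rewrite 2 [← one_smul K (vertVal K G w * vertVal K G w)]
    rw [← add_smul, ← h1, zero_smul]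
  exact (smul_eq_zero.1 h).resolve_left h2

theorem bos_mul_fer {v w : V} (hv : v ∈ G.bos) (hw : w ∉ G.bos) :
    vertVal K G v * vertVal K G w = vertVal K G w * vertVal K G v := by
  simpa [mkAlgHom_fv] using RingQuot.mkAlgHom_rel K (Rel.bos_fer (K := K) v w hv hw)

theorem vert_mul_arr (v : V) (a : Arrow E) :
    vertVal K G v * arrVal K G a = vertVal K G v * vertVal K G (G.asrc a) * arrVal K G a := by
  simpa [mkAlgHom_fv, mkAlgHom_fa] using
    RingQuot.mkAlgHom_rel K (Rel.mul_vert_arr (K := K) (G := G) v a)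

theorem arr_mul_vert (a : Arrow E) (v : V) :
    arrVal K G a * vertVal K G v = arrVal K G a * (vertVal K G (G.arng a) * vertVal K G v) := by
  simpa [mkAlgHom_fv, mkAlgHom_fa] using
    RingQuot.mkAlgHom_rel K (Rel.mul_arr_vert (K := K) (G := G) a v)

theorem arr_mul_arr (a b : Arrow E) :
    arrVal K G a * arrVal K G b =
      arrVal K G a * (vertVal K G (G.arng a) * vertVal K G (G.asrc b)) * arrVal K G b := by
  simpa [mkAlgHom_fv, mkAlgHom_fa] using
    RingQuot.mkAlgHom_rel K (Rel.mul_arr_arr (K := K) (G := G) a b)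

theorem src_mul_arr_fer {a : Arrow E} (ha : G.asrc a ∉ G.bos) :
    vertVal K G (G.asrc a) * arrVal K G a = 0 := by
  simpa [mkAlgHom_fv, mkAlgHom_fa] using RingQuot.mkAlgHom_rel K (Rel.src_fer (K := K) a ha)

theorem arr_mul_rng_fer {a : Arrow E} (ha : G.arng a ∉ G.bos) :
    arrVal K G a * vertVal K G (G.arng a) = 0 := by
  simpa [mkAlgHom_fv, mkAlgHom_fa] using RingQuot.mkAlgHom_rel K (Rel.rng_fer (K := K) a ha)

theorem bos_mul_arr {v : V} (hv : v ∈ G.bos) (a : Arrow E) :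
    vertVal K G v * arrVal K G a = if v = G.asrc a then arrVal K G a else 0 := by
  by_cases ha : G.asrc a ∈ G.bos
  · split_ifs with h
    · rw [h]
      simpa [mkAlgHom_fv, mkAlgHom_fa] using RingQuot.mkAlgHom_rel K (Rel.src_bos (K := K) a ha)
    · rw [vert_mul_arr, bos_mul_bos hv ha, if_neg h, zero_mul]
  · rw [if_neg (ne_of_mem_of_not_mem hv ha), vert_mul_arr, mul_assoc, src_mul_arr_fer ha, mul_zero]

theorem arr_mul_bos {v : V} (hv : v ∈ G.bos) (a : Arrow E) :
    arrVal K G a * vertVal K G v = if v = G.arng a then arrVal K G a else 0 := by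
  by_cases ha : G.arng a ∈ G.bos
  · split_ifs with h
    · rw [h]
      simpa [mkAlgHom_fv, mkAlgHom_fa] using RingQuot.mkAlgHom_rel K (Rel.rng_bos (K := K) a ha)
    · rw [arr_mul_vert, bos_mul_bos ha hv, if_neg (Ne.symm h), mul_zero]
  · rw [if_neg (ne_of_mem_of_not_mem hv ha), arr_mul_vert, ← mul_assoc, arr_mul_rng_fer ha, zero_mul]

theorem letter_mul_arr_of_asrc_fer {a : Arrow E} (ha : G.asrc a ∉ G.bos) (x : Letter V E) :
    letterVal K G x * arrVal K G a = 0 := by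
  rcases x with v | b
  · rw [letterVal, vert_mul_arr, mul_assoc, src_mul_arr_fer ha, mul_zero]
  · rw [letterVal, arr_mul_arr, mul_assoc, mul_assoc, src_mul_arr_fer ha, mul_zero, mul_zero]

theorem arr_mul_letter_of_arng_fer {a : Arrow E} (ha : G.arng a ∉ G.bos) (x : Letter V E) :
    arrVal K G a * letterVal K G x = 0 := by
  rcases x with v | b
  · rw [letterVal, arr_mul_vert, ← mul_assoc, arr_mul_rng_fer ha, zero_mul]
  · rw [letterVal, arr_mul_arr, ← mul_assoc, arr_mul_rng_fer ha, zero_mul, zero_mul]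

theorem arr_mul_word_of_arng_fer {a : Arrow E} (ha : G.arng a ∉ G.bos) {u : List (Letter V E)}
    (hu : u ≠ []) : arrVal K G a * wordVal K G u = 0 := by
  rw [← List.cons_head_tail hu, wordVal_cons, ← mul_assoc, arr_mul_letter_of_arng_fer ha,
    zero_mul]

theorem ghost_mul_real {e f : E} (he : G.IsBosonicEdge e) (hf : G.IsBosonicEdge f) :
    arrVal K G (.ghost e) * arrVal K G (.real f) =
      if e = f then vertVal K G (G.rng e) else 0 := by
  split_ifs with h
  · subst h
    simpa [mkAlgHom_fv, mkAlgHom_fa] using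
      RingQuot.mkAlgHom_rel K (Rel.ghost_self_bos (K := K) e he)
  · simpa [mkAlgHom_fv, mkAlgHom_fa] using
      RingQuot.mkAlgHom_rel K (Rel.ghost_ne (K := K) e f he hf h)

theorem ghost_mul_self_of_not_bosonic {e : E} (he : ¬ G.IsBosonicEdge e) :
    arrVal K G (.ghost e) * arrVal K G (.real e) = 0 := by
  simpa [mkAlgHom_fv, mkAlgHom_fa] using
    RingQuot.mkAlgHom_rel K (Rel.ghost_self_fer (K := K) e he)

theorem vert_regular {v : V} (hv : v ∈ G.regBos) :
    vertVal K G v = ∑ f ∈ bosOut G v, arrVal K G (.real f) * arrVal K G (.ghost f) := by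
  simpa [mkAlgHom_fv, mkAlgHom_fa] using
    RingQuot.mkAlgHom_rel K (Rel.regular (K := K) v (bosOut G v) hv (mem_bosOut hv))

/-! ### Reading normal forms as words; the intertwining map -/

variable [LinearOrder V]

/-- The increasing word in the elements of `S`. -/
def ferWord (E : Type*) (S : Finset V) : List (Letter V E) := S.sort.map .vert

/-- The word encoded by a pair `(S, c)`. -/
def formWord : Finset V → Core V E → List (Letter V E)
  | S, .nil => ferWord E S
  | S, .bos v => .vert v :: ferWord E S
  | S, .cons a T c => ferWord E S ++ .arr a :: formWord T c

@[simp] theorem ferWord_empty : ferWord E (∅ : Finset V) = [] := by simp [ferWord]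

theorem ferWord_insert {w : V} {S : Finset V} (h : ∀ w' ∈ S, w < w') :
    ferWord E (insert w S) = .vert w :: ferWord E S := by
  rw [ferWord, Finset.sort_insert _ (fun b hb => (h b hb).le) fun hw => (h w hw).false]
  rfl

theorem ferWord_ne_nil {S : Finset V} (h : S ≠ ∅) : ferWord E S ≠ [] := by
  intro h'
  have := congrArg List.length h'
  simp [ferWord, h] at this

theorem formWord_empty_cons (a : Arrow E) (T : Finset V) (c : Core V E) :
    formWord ∅ (.cons a T c) = .arr a :: formWord T c := by
  simp [formWord]

theorem bos_mul_ferWord {v : V} (hv : v ∈ G.bos) {S : Finset V} (hS : ∀ w ∈ S, w ∉ G.bos) :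
    vertVal K G v * wordVal K G (ferWord E S) = wordVal K G (ferWord E S) * vertVal K G v := by
  induction S using Finset.induction_on_min with
  | empty => simp [wordVal_nil]
  | insert w S hw ih =>
    rw [ferWord_insert hw, wordVal_cons, ← mul_assoc, bos_mul_fer hv (hS w (by simp)), mul_assoc,
      mul_assoc, ih fun w' hw' => hS w' (by simp [hw'])]

/-- Insertion sort: `w` moves past each smaller letter at the cost of a sign, and a repetition gives
`w² = 0`. Induction on the minimum matches the first letter of the sorted word. -/
theorem fer_mul_ferWord (hK : ringChar K ≠ 2) {w : V} (hw : w ∉ G.bos) {S : Finset V}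
    (hS : ∀ w ∈ S, w ∉ G.bos) :
    vertVal K G w * wordVal K G (ferWord E S) = if w ∈ S then 0 else
      (-1 : K) ^ (S.filter (· < w)).card • wordVal K G (ferWord E (insert w S)) := by
  induction S using Finset.induction_on_min with
  | empty =>
    have : ferWord E {w} = [.vert w] := by simp [ferWord]
    simp [wordVal_nil, this]
  | insert m S hm ih =>
    have ih := ih fun w' hw' => hS w' (by simp [hw'])
    rcases lt_trichotomy w m with h | rfl | h
    · have h' : ∀ w' ∈ insert m S, w < w' := by
        intro w' hw'
        rcases Finset.mem_insert.1 hw' with rfl | hw'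
        exacts [h, h.trans (hm _ hw')]
      have hmem : w ∉ insert m S := fun hw' => (h' w hw').false
      have hfil : (insert m S).filter (· < w) = ∅ :=
        Finset.filter_eq_empty_iff.2 fun x hx => (h' x hx).not_gt
      rw [if_neg hmem, hfil, ferWord_insert h', wordVal_cons]
      simp
    · rw [if_pos (Finset.mem_insert_self _ _), ferWord_insert hm, wordVal_cons, ← mul_assoc,
        fer_mul_self hK hw, zero_mul]
    · rw [ferWord_insert hm, wordVal_cons, ← mul_assoc, fer_mul_fer hw (hS m (by simp)),
        smul_mul_assoc, mul_assoc, ih]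
      by_cases hwS : w ∈ S
      · simp [hwS]
      · have hmem : w ∉ insert m S := by simp [hwS, h.ne']
        have hmS : m ∉ S := fun h => (hm m h).false
        have hcard : ((insert m S).filter (· < w)).card = (S.filter (· < w)).card + 1 := by
          rw [Finset.filter_insert, if_pos h, Finset.card_insert_of_notMem (by simp [hmS])]
        have hmin : ∀ w' ∈ insert w S, m < w' := by
          intro w' hw'
          rcases Finset.mem_insert.1 hw' with rfl | hw'
          exacts [h, hm _ hw']
        rw [if_neg hwS, if_neg hmem, hcard, Finset.insert_comm, ferWord_insert hmin,
          wordVal_cons _ (ferWord E (insert w S)), mul_smul_comm, pow_succ', mul_smul]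

/-- If `r(a)` is Bosonic, write `a = a r(a)` and commute `r(a)` through the Fermionic block until it
meets and kills `b`. If it is Fermionic, `a` kills whatever follows. -/
theorem arr_mul_ferWord_mul_arr {a b : Arrow E} (hab : G.arng a ≠ G.asrc b) {S : Finset V}
    (hS : ∀ w ∈ S, w ∉ G.bos) :
    arrVal K G a * (wordVal K G (ferWord E S) * arrVal K G b) = 0 := by
  by_cases ha : G.arng a ∈ G.bos
  · have h : arrVal K G a * vertVal K G (G.arng a) = arrVal K G a := by
      rw [arr_mul_bos ha, if_pos rfl]
    rw [← h, mul_assoc, ← mul_assoc (vertVal K G _), bos_mul_ferWord ha hS, mul_assoc,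
      bos_mul_arr ha, if_neg hab, mul_zero, mul_zero]
  · rw [← wordVal_append, arr_mul_word_of_arng_fer ha (by simp)]

variable (γ : SpecialEdges G)

variable (K) in
/-- The linear map from the module of normal forms to the algebra. -/
noncomputable def formEval : FormModule γ K →ₗ[K] UnitalSL K G :=
  Finsupp.linearCombination K fun r => wordVal K G (formWord r.1.1 r.1.2)

variable {γ}

theorem formEval_form {r : Finset V × Core V E} (h : IsForm γ r) :
    formEval K γ (form γ K r) = wordVal K G (formWord r.1 r.2) := by
  simp [formEval, form_of_isForm K h]

theorem formEval_bosAct {v : V} (hv : v ∈ G.bos) {r : Finset V × Core V E} (h : IsForm γ r) :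
    formEval K γ (bosAct γ K v r) = vertVal K G v * wordVal K G (formWord r.1 r.2) := by
  rcases r with ⟨S, _ | u | ⟨a, T, c⟩⟩
  · have : IsForm γ (S, .bos v) := ⟨hv, h.2.1, .inl trivial⟩
    rw [bosAct, formEval_form this]
    exact wordVal_cons _ _
  · rw [bosAct, formWord, wordVal_cons, ← mul_assoc, bos_mul_bos hv h.1]
    split_ifs
    · rw [formEval_form h, formWord, wordVal_cons]
    · simp
  · rw [bosAct, formWord, wordVal_append, wordVal_cons, ← mul_assoc, bos_mul_ferWord hv h.2.1,
      mul_assoc, ← mul_assoc (vertVal K G v), bos_mul_arr hv]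
    split_ifs
    · rw [formEval_form h, formWord, wordVal_append, wordVal_cons]
    · simp

theorem formEval_ferAct (hK : ringChar K ≠ 2) {w : V} (hw : w ∉ G.bos)
    {r : Finset V × Core V E} (h : IsForm γ r) :
    formEval K γ (ferAct γ K w r) = vertVal K G w * wordVal K G (formWord r.1 r.2) := by
  obtain ⟨S, c⟩ := r
  have key : c.Prefixable G → IsForm γ (insert w S, c) := fun hc =>
    ⟨h.1, by simpa [hw] using h.2.1, .inl hc⟩
  have hL : c.Prefixable G → formEval K γ (ferAct γ K w (S, c)) = if w ∈ S then 0 else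
      (-1 : K) ^ (S.filter (· < w)).card • wordVal K G (formWord (insert w S) c) := by
    intro hc
    rw [ferAct]
    split_ifs
    · simp
    · rw [map_smul, formEval_form (key hc)]
  rcases c with _ | u | ⟨a, T, c⟩
  · rw [hL trivial]
    exact (fer_mul_ferWord hK hw h.2.1).symm
  · rw [hL trivial]
    simp only [formWord]
    rw [wordVal_cons, wordVal_cons _ (ferWord E S), ← mul_assoc,
      ← bos_mul_fer h.1 hw, mul_assoc, fer_mul_ferWord hK hw h.2.1]
    split_ifs <;> simp
  · by_cases ha : G.asrc a ∈ G.bos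
    · rw [hL ha]
      simp only [formWord]
      rw [wordVal_append, wordVal_append, ← mul_assoc, fer_mul_ferWord hK hw h.2.1]
      split_ifs <;> simp
    · have hS : S = ∅ := h.2.2.resolve_left ha
      subst hS
      rw [ferAct, if_neg (by simp), form_of_not_isForm, smul_zero, map_zero]
      · simp only [formWord, ferWord_empty, List.nil_append]
        rw [wordVal_cons, ← mul_assoc]
        exact (by rw [letter_mul_arr_of_asrc_fer ha, zero_mul])
      · rintro ⟨-, -, h | h⟩
        · exact ha h
        · simp at h

theorem formEval_arrAct (a : Arrow E) {r : Finset V × Core V E} (h : IsForm γ r) :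
    formEval K γ (arrAct γ K a r) = arrVal K G a * wordVal K G (formWord r.1 r.2) := by
  have hnil : ∀ {S : Finset V}, (∀ w ∈ S, w ∉ G.bos) → formEval K γ (form γ K (∅, .cons a S .nil)) =
      arrVal K G a * wordVal K G (ferWord E S) := by
    intro S hS
    by_cases h0 : G.arng a ∉ G.bos → S = ∅
    · have : IsForm γ (∅, .cons a S .nil) := ⟨⟨trivial, hS, h0⟩, by simp, .inr rfl⟩
      rw [formEval_form this, formWord_empty_cons, wordVal_cons]
      rfl
    · have : ¬ IsForm γ (∅, .cons a S .nil) := fun h => h0 h.1.2.2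
      rw [form_of_not_isForm K this, map_zero]
      push Not at h0
      rw [arr_mul_word_of_arng_fer h0.1 (ferWord_ne_nil h0.2.ne_empty)]
  rcases r with ⟨S, _ | u | ⟨b, T, c⟩⟩
  · exact hnil h.2.1
  · rw [arrAct, formWord, wordVal_cons, ← mul_assoc, arr_mul_bos h.1]
    split_ifs
    · exact hnil h.2.1
    · simp
  · rw [arrAct]
    split_ifs with hc
    · obtain ⟨rfl, hc⟩ := hc
      simp only [formWord_empty_cons]
      rw [wordVal_cons, ← mul_assoc]
      rcases a with e | e <;> rcases b with f | f
      · exact hc.elim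
      -- Solve the regular-vertex relation for the special term `e e*`; this is the expansion used
      -- in `clashAct`.
      · obtain ⟨rfl, hs⟩ := hc
        have hb := hs.isBosonicEdge
        have hm : e ∈ bosOut G (G.src e) := (mem_bosOut hs.regBos e).2 ⟨rfl, hs.rng⟩
        have hreg := vert_regular (K := K) hs.regBos
        rw [← Finset.add_sum_erase _ _ hm] at hreg
        have heq := eq_sub_of_add_eq hreg.symm
        simp only [arrVal] at heq ⊢
        rw [heq, clashAct, map_sub, formEval_bosAct hb.1 h.tail,
          sub_mul, map_sum, Finset.sum_mul]
        congr 1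
        refine Finset.sum_congr rfl fun f hf => ?_
        rw [Finset.mem_erase, mem_bosOut hs.regBos] at hf
        have hfb : G.IsBosonicEdge f := ⟨hf.2.1 ▸ hb.1, hf.2.2⟩
        rw [formEval_form ((h.ghost_of_special hb hfb hf.2.1).real_ghost hfb
          fun h => hf.1 (h.eq_of_src hs hf.2.1)), formWord_empty_cons, formWord_empty_cons,
          wordVal_cons, wordVal_cons _ (formWord T c), mul_assoc]
      · rw [clashAct]
        split_ifs with hef
        · obtain ⟨rfl, hb⟩ := hef
          rw [formEval_bosAct hb.2 h.tail, ghost_mul_real hb hb, if_pos rfl]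
        · rcases hc with rfl | ⟨he, hf⟩
          · rw [ghost_mul_self_of_not_bosonic fun hb => hef ⟨rfl, hb⟩, zero_mul, map_zero]
          · rw [ghost_mul_real he hf, if_neg fun h => hef ⟨h, he⟩, zero_mul, map_zero]
      · exact hc.elim
    -- With no clash the word is prepended unchanged, unless `a` cannot precede `b`; then `form` is
    -- `0` by default, and the product vanishes in the algebra too.
    · by_cases hab : G.arng a = G.asrc b
      · by_cases ha : G.arng a ∈ G.bos
        · have : IsForm γ (∅, .cons a S (.cons b T c)) :=
            ⟨⟨h.1, h.2.1, ha, hab, fun h1 h2 => hc ⟨h1, h2⟩⟩, by simp, .inr rfl⟩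
          rw [formEval_form this, formWord_empty_cons, wordVal_cons]
        · have : ¬ IsForm γ (∅, .cons a S (.cons b T c)) := fun h => ha h.1.2.2.1
          rw [form_of_not_isForm K this, map_zero,
            arr_mul_word_of_arng_fer ha (by simp [formWord])]
      · have : ¬ IsForm γ (∅, .cons a S (.cons b T c)) := fun h => hab h.1.2.2.2.1
        rw [form_of_not_isForm K this, map_zero]
        have h0 := arr_mul_ferWord_mul_arr (K := K) hab h.2.1
        rw [← mul_assoc] at h0
        simp only [formWord]
        rw [wordVal_append, wordVal_cons, ← mul_assoc (wordVal K G _), ← mul_assoc, h0, zero_mul]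

/-- Each reduction built into the action is an identity of the algebra, so evaluation turns the
action into left multiplication. -/
theorem formEval_letterOp (hK : ringChar K ≠ 2) (x : Letter V E) (n : FormModule γ K) :
    formEval K γ (letterOp γ K x n) = wordVal K G [x] * formEval K γ n := by
  suffices h : formEval K γ ∘ₗ letterOp γ K x =
      LinearMap.mulLeft K (wordVal K G [x]) ∘ₗ formEval K γ from LinearMap.congr_fun h n
  refine Finsupp.lhom_ext' fun r => LinearMap.ext_ring ?_
  have hr := form_of_isForm K r.2
  simp only [LinearMap.comp_apply, Finsupp.lsingle_apply, LinearMap.mulLeft_apply]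
  rw [← hr, letterOp_form _ r.2, formEval_form r.2]
  rcases x with v | a
  · rw [letterAct]
    split_ifs with hv
    · exact formEval_bosAct hv r.2
    · exact formEval_ferAct hK hv r.2
  · exact formEval_arrAct a r.2

variable (K γ) in
/-- The normal form of the empty word. -/
noncomputable def emptyForm : FormModule γ K := form γ K (∅, .nil)

omit [LinearOrder V] in
theorem isForm_empty : IsForm γ ((∅, .nil) : Finset V × Core V E) :=
  ⟨trivial, by simp, .inr rfl⟩

theorem formRep_cons (x : Letter V E) (u : List (Letter V E)) (n : FormModule γ K) :
    formRep γ K (wordVal K G (x :: u)) n =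
      letterOp γ K x (formRep γ K (wordVal K G u) n) := by
  rw [wordVal_cons, map_mul, formRep_singleton, Module.End.mul_apply]

theorem formEval_formRep (hK : ringChar K ≠ 2) (u : List (Letter V E)) :
    formEval K γ (formRep γ K (wordVal K G u) (emptyForm K γ)) = wordVal K G u := by
  induction u with
  | nil =>
    rw [wordVal_nil, map_one, Module.End.one_apply, emptyForm, formEval_form isForm_empty]
    simp [formWord, wordVal_nil]
  | cons x u ih => rw [formRep_cons, formEval_letterOp hK, ih, ← wordVal_cons]

end Evaluation

/-! ### Normal forms and irreducible words correspond -/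

section IrreducibleWords

variable {V E : Type*} {G : SuperGraph V E} {γ : SpecialEdges G} [LinearOrder V]

theorem isIrreducibleWord_nil : IsIrreducibleWord γ ([] : List (Letter V E)) := by
  intro t ht hp
  rw [List.infix_nil] at hp
  subst hp
  generalize h : ([] : List (Letter V E)) = t at ht
  cases ht <;> simp at h

theorem IsIrreducibleWord.of_cons {x : Letter V E} {u : List (Letter V E)}
    (h : IsIrreducibleWord γ (x :: u)) : IsIrreducibleWord γ u :=
  fun t ht hp => h t ht (hp.trans (List.suffix_cons x u).isInfix)

theorem IsIrreducibleWord.not_prefix {u t : List (Letter V E)}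
    (h : IsIrreducibleWord γ u) (ht : IsReducibleFactor γ t) : ¬ t <+: u :=
  fun hp => h t ht hp.isInfix

theorem IsIrreducibleWord.cons {x : Letter V E} {u : List (Letter V E)}
    (hu : IsIrreducibleWord γ u) (h : ∀ t, IsReducibleFactor γ t → ¬ t <+: x :: u) :
    IsIrreducibleWord γ (x :: u) := fun t ht hp =>
  (List.infix_cons_iff.1 hp).elim (h t ht) (hu t ht)

theorem isIrreducibleWord_singleton (x : Letter V E) : IsIrreducibleWord γ [x] := by
  refine isIrreducibleWord_nil.cons fun t ht hp => ?_
  have hl := hp.length_le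
  cases ht <;> simp at hl

theorem IsIrreducibleWord.fer_cons {w : V} (hw : w ∉ G.bos) {u : List (Letter V E)}
    (hu : IsIrreducibleWord γ u) (h1 : ∀ w' u', u = .vert w' :: u' → w' ∉ G.bos ∧ w < w')
    (h2 : ∀ a u', u = .arr a :: u' → G.asrc a ∈ G.bos) : IsIrreducibleWord γ (.vert w :: u) := by
  refine hu.cons fun t ht hp => ?_
  obtain ⟨s, hs⟩ := hp
  cases ht with
  | bos_bos v v' hv hv' =>
    simp only [List.cons_append, List.cons.injEq, Letter.vert.injEq] at hs
    exact hw (hs.1 ▸ hv)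
  | fer_fer v w' hv hw' h =>
    simp only [List.cons_append, List.cons.injEq, Letter.vert.injEq] at hs
    exact (h1 _ _ hs.2.symm).2.not_ge (hs.1 ▸ h)
  | fer_bos v w' hv hw' =>
    simp only [List.cons_append, List.cons.injEq, Letter.vert.injEq] at hs
    exact (h1 _ _ hs.2.symm).1 hw'
  | bos_arr v W a hv hW =>
    simp only [List.cons_append, List.cons.injEq, Letter.vert.injEq] at hs
    exact hw (hs.1 ▸ hv)
  | src_fer x a ha =>
    simp only [List.cons_append, List.cons.injEq] at hs
    exact ha (h2 _ _ hs.2.symm)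
  | _ => simp at hs

/-- Only factors starting at the new arrow need checking. The last hypothesis ranges over all blocks
`W` because the factors `a W b` have unbounded length. -/
theorem IsIrreducibleWord.arr_cons {a : Arrow E} {u : List (Letter V E)}
    (hu : IsIrreducibleWord γ u) (h0 : u ≠ [] → G.arng a ∈ G.bos)
    (h1 : ∀ v u', u = .vert v :: u' → v ∉ G.bos)
    (h2 : ∀ (W : List V) b u', u = W.map .vert ++ .arr b :: u' → (∀ w ∈ W, w ∉ G.bos) →
      G.arng a = G.asrc b ∧ (W = [] → ¬ Clash γ a b)) :
    IsIrreducibleWord γ (.arr a :: u) := by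
  refine hu.cons fun t ht hp => ?_
  obtain ⟨s, hs⟩ := hp
  cases ht with
  | arr_bos b v hv =>
    simp only [List.cons_append, List.cons.injEq] at hs
    exact h1 _ _ hs.2.symm hv
  | arr_arr b W b' hb hW =>
    simp only [List.cons_append, List.append_assoc, List.cons.injEq, Letter.arr.injEq,
      List.nil_append] at hs
    obtain ⟨rfl, hs⟩ := hs
    exact hb (h2 W b' _ hs.symm hW).1
  | src_fer x b hb =>
    simp only [List.cons_append, List.nil_append, List.cons.injEq] at hs
    have := (h2 [] b _ hs.2.symm (by simp)).1
    exact hb (this ▸ h0 (by simp [← hs.2]))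
  | rng_fer b x hb =>
    simp only [List.cons_append, List.nil_append, List.cons.injEq, Letter.arr.injEq] at hs
    exact hb (hs.1 ▸ h0 (by simp [← hs.2]))
  | ghost_self e =>
    simp only [List.cons_append, List.nil_append, List.cons.injEq, Letter.arr.injEq] at hs
    obtain ⟨rfl, hs⟩ := hs
    exact (h2 [] _ _ hs.symm (by simp)).2 rfl (.inl rfl)
  | ghost_bos e e' he he' hne =>
    simp only [List.cons_append, List.nil_append, List.cons.injEq, Letter.arr.injEq] at hs
    obtain ⟨rfl, hs⟩ := hs
    exact (h2 [] _ _ hs.symm (by simp)).2 rfl (.inr ⟨he, he'⟩)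
  | special e he =>
    simp only [List.cons_append, List.nil_append, List.cons.injEq, Letter.arr.injEq] at hs
    obtain ⟨rfl, hs⟩ := hs
    exact (h2 [] _ _ hs.symm (by simp)).2 rfl ⟨rfl, he⟩
  | _ => simp at hs

theorem arr_notMem_ferWord (a : Arrow E) (S : Finset V) : .arr a ∉ ferWord E S := by
  simp [ferWord]

theorem mem_of_vert_mem_ferWord {v : V} {S : Finset V} (h : .vert v ∈ ferWord E S) : v ∈ S := by
  simpa [ferWord] using h

theorem IsIrreducibleWord.bos_cons {v : V} (hv : v ∈ G.bos) {S : Finset V}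
    (hS : ∀ w ∈ S, w ∉ G.bos) (hu : IsIrreducibleWord γ (ferWord E S)) :
    IsIrreducibleWord γ (.vert v :: ferWord E S) := by
  refine hu.cons fun t ht hp => ?_
  obtain ⟨s, hs⟩ := hp
  cases ht with
  | bos_bos v' v'' hv hv' =>
    simp only [List.cons_append, List.cons.injEq, Letter.vert.injEq] at hs
    exact hS _ (mem_of_vert_mem_ferWord (E := E) (by simp [← hs.2])) hv'
  | fer_fer w w' hw hw' h =>
    simp only [List.cons_append, List.cons.injEq, Letter.vert.injEq] at hs
    exact hw (hs.1 ▸ hv)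
  | fer_bos w v' hw hv' =>
    simp only [List.cons_append, List.cons.injEq, Letter.vert.injEq] at hs
    exact hw (hs.1 ▸ hv)
  | bos_arr v' W a hv hW =>
    simp only [List.cons_append, List.cons.injEq] at hs
    exact arr_notMem_ferWord a S (by simp [← hs.2])
  | src_fer x a ha =>
    simp only [List.cons_append, List.cons.injEq] at hs
    exact arr_notMem_ferWord a S (by simp [← hs.2])
  | _ => simp at hs

theorem IsIrreducibleWord.ferWord_append {S : Finset V} (hS : ∀ w ∈ S, w ∉ G.bos)
    {u : List (Letter V E)} (hu : IsIrreducibleWord γ u) (h1 : ∀ v u', u ≠ .vert v :: u')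
    (h2 : ∀ a u', u = .arr a :: u' → G.asrc a ∈ G.bos ∨ S = ∅) :
    IsIrreducibleWord γ (ferWord E S ++ u) := by
  induction S using Finset.induction_on_min with
  | empty => simpa using hu
  | insert w S hw ih =>
    have h2' : ∀ a u', u = .arr a :: u' → G.asrc a ∈ G.bos := fun a u' h =>
      (h2 a u' h).resolve_right (by simp)
    rw [ferWord_insert hw, List.cons_append]
    refine (ih (fun w' hw' => hS w' (by simp [hw'])) fun a u' h => .inl (h2' a u' h)).fer_cons
      (hS w (by simp)) ?_ ?_
    · intro w' u' h
      rcases List.append_eq_cons_iff.1 h with ⟨-, h⟩ | ⟨s, h, -⟩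
      · exact (h1 _ _ h).elim
      · have := mem_of_vert_mem_ferWord (E := E) (S := S) (v := w') (by simp [h])
        exact ⟨hS w' (by simp [this]), hw w' this⟩
    · intro a u' h
      rcases List.append_eq_cons_iff.1 h with ⟨-, h⟩ | ⟨s, h, -⟩
      · exact h2' _ _ h
      · exact (arr_notMem_ferWord a S (by simp [h])).elim

/-- The first arrow of a word marks the end of its initial block of vertices, so the decomposition
is unique. -/
theorem ferWord_append_arr_inj {W : List V} {S : Finset V} {a b : Arrow E}
    {u u' : List (Letter V E)} (h : ferWord E S ++ .arr a :: u = W.map .vert ++ .arr b :: u') :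
    S.sort = W ∧ a = b ∧ u = u' := by
  rw [ferWord] at h
  generalize S.sort = L at h ⊢
  induction L generalizing W with
  | nil =>
    cases W with
    | nil => simpa using h
    | cons => simp at h
  | cons w L ih =>
    cases W with
    | nil => simp at h
    | cons w' W =>
      simp only [List.map_cons, List.cons_append, List.cons.injEq, Letter.vert.injEq] at h
      obtain ⟨h1, h2⟩ := ih h.2
      exact ⟨by rw [h.1, h1], h2⟩

theorem IsForm.isIrreducibleWord {S : Finset V} {c : Core V E} (h : IsForm γ (S, c)) :
    IsIrreducibleWord γ (formWord S c) := by
  have hfer : ∀ S : Finset V, (∀ w ∈ S, w ∉ G.bos) → IsIrreducibleWord γ (ferWord E S) := by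
    intro S hS
    simpa using isIrreducibleWord_nil.ferWord_append hS (by simp) (by simp)
  induction c generalizing S with
  | nil => exact hfer S h.2.1
  | bos v => exact (hfer S h.2.1).bos_cons h.1 h.2.1
  | cons a T c ih =>
    rw [formWord]
    refine IsIrreducibleWord.ferWord_append h.2.1 ?_ (by simp) ?_
    · refine (ih h.tail).arr_cons ?_ ?_ ?_
      · intro hne
        rcases c with _ | v | ⟨b, T', c⟩
        · by_contra ha
          rw [h.1.2.2 ha] at hne
          exact hne (by simp [formWord])
        · exact h.1.2.2.elim
        · exact h.1.2.2.1
      · intro v u' hu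
        have key : .vert v ∈ ferWord E T → v ∉ G.bos := fun hv =>
          h.1.2.1 v (mem_of_vert_mem_ferWord hv)
        rcases c with _ | v | ⟨b, T', c⟩
        · exact key (by simp [show ferWord E T = _ from hu])
        · exact h.1.2.2.elim
        · rcases List.append_eq_cons_iff.1 hu with ⟨-, hu⟩ | ⟨s, hs, -⟩
          · simp at hu
          · exact key (by simp [hs])
      · intro W b u' hu hW
        rcases c with _ | v | ⟨b', T', c⟩
        · exact (arr_notMem_ferWord b T (by simp [show ferWord E T = _ from hu])).elim
        · exact h.1.2.2.elim
        · obtain ⟨rfl, rfl, rfl⟩ := ferWord_append_arr_inj hu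
          refine ⟨h.1.2.2.2.1, fun hT => h.1.2.2.2.2 ?_⟩
          have := congrArg List.length hT
          simpa using this
    · rintro b u' hb
      simp only [List.cons.injEq, Letter.arr.injEq] at hb
      exact hb.1 ▸ h.2.2

theorem exists_ferWord_eq_cons {S : Finset V} (hS : S ≠ ∅) :
    ∃ m ∈ S, (∀ w ∈ S, m ≤ w) ∧ ∃ u, ferWord E S = .vert m :: u := by
  have hS' := Finset.nonempty_iff_ne_empty.2 hS
  refine ⟨S.min' hS', S.min'_mem hS', fun w hw => S.min'_le w hw, ferWord E (S.erase (S.min' hS')),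
    ?_⟩
  rw [← ferWord_insert, Finset.insert_erase (S.min'_mem hS')]
  intro w hw
  exact lt_of_le_of_ne (S.min'_le w (Finset.mem_of_mem_erase hw)) (Finset.ne_of_mem_erase hw).symm

theorem map_sort_prefix {S : Finset V} (x : Letter V E) (a : Arrow E) (u : List (Letter V E)) :
    x :: S.sort.map .vert ++ [.arr a] <+: x :: (ferWord E S ++ .arr a :: u) :=
  ⟨u, by simp [ferWord]⟩

variable (K : Type*) [Field K]

/-- Whenever the action does something other than prepend `x` with coefficient `1`, the word `x ::
formWord S c` has a reducible prefix. This links the list of reducible factors to the case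
distinctions in `letterAct`. -/
theorem exists_form_of_cons {x : Letter V E} {S : Finset V} {c : Core V E} (h : IsForm γ (S, c))
    (hx : IsIrreducibleWord γ (x :: formWord S c)) :
    ∃ S' c', IsForm γ (S', c') ∧ formWord S' c' = x :: formWord S c ∧
      letterAct γ K x (S, c) = form γ K (S', c') := by
  have hsort : ∀ w ∈ S.sort, w ∉ G.bos := fun w hw => h.2.1 w ((Finset.mem_sort _).1 hw)
  rcases x with v | a
  · by_cases hv : v ∈ G.bos
    · rcases c with _ | u | ⟨b, T, c⟩
      · exact ⟨S, .bos v, ⟨hv, h.2.1, .inl trivial⟩, rfl, by simp [letterAct, hv, bosAct]⟩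
      · exact (hx.not_prefix (.bos_bos v u hv h.1) ⟨ferWord E S, rfl⟩).elim
      · exact (hx.not_prefix (.bos_arr v S.sort b hv hsort) (map_sort_prefix _ _ _)).elim
    -- Irreducibility forces `v` below the first letter of the sorted block, hence below all of `S`;
    -- the sign in `ferAct` is then `1`.
    · have hlt : (∃ u, formWord S c = ferWord E S ++ u) → ∀ w ∈ S, v < w := by
        rintro ⟨u, hu⟩ w hw
        obtain ⟨m, hm, hmin, u', hu'⟩ := exists_ferWord_eq_cons (E := E) (Finset.ne_empty_of_mem hw)
        refine lt_of_lt_of_le (lt_of_not_ge fun hmv => ?_) (hmin w hw)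
        exact hx.not_prefix (.fer_fer v m hv (h.2.1 m hm) hmv) ⟨u' ++ u, by simp [hu, hu']⟩
      have key : ∀ hlt : ∀ w ∈ S, v < w, letterAct γ K (.vert v) (S, c) =
          form γ K (insert v S, c) := by
        intro hlt
        have h1 : v ∉ S := fun h => (hlt v h).false
        have h2 : S.filter (· < v) = ∅ :=
          Finset.filter_eq_empty_iff.2 fun w hw => (hlt w hw).not_gt
        simp [letterAct, hv, ferAct, h1, h2]
      have hins : ∀ w ∈ insert v S, w ∉ G.bos := by simpa [hv] using h.2.1
      rcases c with _ | u | ⟨b, T, c⟩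
      · have hlt := hlt ⟨[], by simp [formWord]⟩
        exact ⟨insert v S, .nil, ⟨trivial, hins, .inl trivial⟩, ferWord_insert hlt, key hlt⟩
      · exact (hx.not_prefix (.fer_bos v u hv h.1) ⟨ferWord E S, rfl⟩).elim
      · have hlt := hlt ⟨_, rfl⟩
        refine ⟨insert v S, .cons b T c, ⟨h.1, hins, .inl ?_⟩, ?_, key hlt⟩
        · by_contra hb
          have hS : S = ∅ := h.2.2.resolve_left hb
          subst hS
          exact hx.not_prefix (.src_fer (.vert v) b hb) ⟨formWord T c, by simp [formWord]⟩
        · rw [formWord, ferWord_insert hlt]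
          rfl
  · have hrng : formWord S c ≠ [] → G.arng a ∈ G.bos := by
      intro hne
      by_contra ha
      refine hx.not_prefix (.rng_fer a ((formWord S c).head hne) ha) ⟨(formWord S c).tail, ?_⟩
      simp
    rcases c with _ | u | ⟨b, T, c⟩
    · refine ⟨∅, .cons a S .nil, ⟨⟨trivial, h.2.1, fun ha => ?_⟩, by simp, .inr rfl⟩,
        formWord_empty_cons _ _ _, rfl⟩
      by_contra hS
      exact ha (hrng (ferWord_ne_nil hS))
    · exact (hx.not_prefix (.arr_bos a u h.1) ⟨ferWord E S, rfl⟩).elim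
    · have ha : G.arng a ∈ G.bos := hrng (by simp [formWord])
      have hab : G.arng a = G.asrc b := by
        by_contra hab
        exact hx.not_prefix (.arr_arr a S.sort b hab hsort) (map_sort_prefix _ _ _)
      have hc : ¬ (S = ∅ ∧ Clash γ a b) := by
        rintro ⟨rfl, hc⟩
        rw [formWord_empty_cons] at hx
        rcases a with e | e <;> rcases b with f | f
        · exact hc
        · obtain ⟨rfl, hs⟩ := hc
          exact hx.not_prefix (.special e hs) ⟨formWord T c, rfl⟩
        · rcases eq_or_ne e f with rfl | hef
          · exact hx.not_prefix (.ghost_self e) ⟨formWord T c, rfl⟩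
          · obtain ⟨he, hf⟩ := hc.resolve_left hef
            exact hx.not_prefix (.ghost_bos e f he hf hef) ⟨formWord T c, rfl⟩
        · exact hc
      refine ⟨∅, .cons a S (.cons b T c), ⟨⟨h.1, h.2.1, ha, hab, fun h1 h2 => hc ⟨h1, h2⟩⟩,
        by simp, .inr rfl⟩, formWord_empty_cons _ _ _, ?_⟩
      rw [letterAct, arrAct, if_neg hc]

theorem exists_form_of_isIrreducibleWord {u : List (Letter V E)} (hu : IsIrreducibleWord γ u) :
    ∃ S c, IsForm γ (S, c) ∧ formWord S c = u ∧
      formRep γ K (wordVal K G u) (emptyForm K γ) = form γ K (S, c) := by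
  induction u with
  | nil =>
    refine ⟨∅, .nil, isForm_empty, by simp [formWord], ?_⟩
    rw [wordVal_nil, map_one, Module.End.one_apply, emptyForm]
  | cons x u ih =>
    obtain ⟨S, c, h, rfl, hu'⟩ := ih hu.of_cons
    obtain ⟨S', c', h', h1, h2⟩ := exists_form_of_cons K h hu
    exact ⟨S', c', h', h1, by rw [formRep_cons, hu', letterOp_form _ h, h2]⟩

omit [LinearOrder V] in
theorem isBasicWord_singleton (x : Letter V E) : IsBasicWord γ [x] := by
  rcases x with v | e | e
  · exact .vert v
  · exact .path [e] ⟨by simp, by simp⟩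
  · exact .ghostPath [e] ⟨by simp, by simp⟩

end IrreducibleWords

/-! ### Basis words, spanning and independence -/

section BasisWords

variable {V E : Type*} {G : SuperGraph V E} {γ : SpecialEdges G} [LinearOrder V]

theorem isIrreducibleWord_map_arr {L : List (Arrow E)}
    (h : L.IsChain fun a b => G.arng a = G.asrc b ∧ G.arng a ∈ G.bos ∧ ¬ Clash γ a b) :
    IsIrreducibleWord γ (L.map .arr : List (Letter V E)) := by
  induction L with
  | nil => exact isIrreducibleWord_nil
  | cons a L ih =>
    rw [List.isChain_cons] at h
    refine (ih h.2).arr_cons ?_ ?_ ?_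
    · intro hL
      rcases L with _ | ⟨b, L⟩
      · exact (hL rfl).elim
      · exact (h.1 b rfl).2.1
    · intro v u' hu
      rcases L with _ | ⟨b, L⟩ <;> simp at hu
    · intro W b u' hu hW
      rcases L with _ | ⟨b', L⟩
      · simp at hu
      · rcases W with _ | ⟨w, W⟩
        · simp only [List.map_cons, List.map_nil, List.nil_append, List.cons.injEq,
            Letter.arr.injEq] at hu
          obtain ⟨rfl, -⟩ := hu
          exact ⟨(h.1 b' rfl).1, fun _ => (h.1 b' rfl).2.2⟩
        · simp at hu

theorem IsBasicWord.isIrreducibleWord {u : List (Letter V E)} (hu : IsBasicWord γ u) :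
    IsIrreducibleWord γ u := by
  have hpath : ∀ p : List E, IsInnerBosonicPath G p → (p.map Arrow.real).IsChain fun a b =>
      G.arng a = G.asrc b ∧ G.arng a ∈ G.bos ∧ ¬ Clash γ a b := by
    intro p hp
    rw [List.isChain_map]
    exact hp.2.imp fun e f h => ⟨h.1, h.2, fun hc => hc.elim⟩
  have hghost : ∀ p : List E, IsInnerBosonicPath G p →
      (p.reverse.map Arrow.ghost).IsChain fun a b =>
        G.arng a = G.asrc b ∧ G.arng a ∈ G.bos ∧ ¬ Clash γ a b := by
    intro p hp
    rw [List.isChain_map, List.isChain_reverse]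
    exact hp.2.imp fun e f h => ⟨h.1.symm, (congrArg (· ∈ G.bos) h.1).mp h.2, fun hc => hc.elim⟩
  cases hu with
  | vert v => exact isIrreducibleWord_singleton _
  | path p hp =>
    have := isIrreducibleWord_map_arr (hpath p hp)
    rwa [List.map_map] at this
  | ghostPath p hp =>
    have := isIrreducibleWord_map_arr (hghost p hp)
    rwa [List.map_map] at this
  | pathGhost p q e f hp hq hef he hne =>
    have h := (hpath _ hp).append (hghost _ hq) (by
      simp only [List.map_append, List.map_cons, List.map_nil, List.getLast?_append,
        List.reverse_append, List.reverse_cons, List.reverse_nil, List.nil_append,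
        List.cons_append, List.head?_cons, Option.mem_def, List.getLast?_singleton,
        Option.some_or, Option.some.injEq]
      rintro _ rfl _ rfl
      refine ⟨hef, he, ?_⟩
      rintro ⟨rfl, hs⟩
      exact hne.elim (fun h => h rfl) fun h => h hs)
    have := isIrreducibleWord_map_arr h
    rwa [List.map_append, List.map_map, List.map_map] at this

omit [LinearOrder V] in
theorem IsBasicWord.ne_nil {u : List (Letter V E)} (hu : IsBasicWord γ u) : u ≠ [] := by
  cases hu with
  | vert v => simp
  | path p hp => simpa [pathWord] using hp.1
  | ghostPath p hp => simpa [ghostWord] using hp.1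
  | pathGhost p q e f => simp [pathWord]

/-- Being a product of basic words is no restriction, since each letter alone is basic; the first
alternative adds nothing because basic words are irreducible. -/
theorem isBasisWord_iff {u : List (Letter V E)} :
    IsBasisWord γ u ↔ u ≠ [] ∧ IsIrreducibleWord γ u := by
  constructor
  · rintro (hu | ⟨L, hL, hb, rfl, hu⟩)
    · exact ⟨hu.ne_nil, hu.isIrreducibleWord⟩
    · refine ⟨fun h => ?_, hu⟩
      obtain ⟨t, ht⟩ := List.exists_mem_of_ne_nil L hL
      exact (hb t ht).ne_nil (List.flatten_eq_nil_iff.1 h t ht)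
  · rintro ⟨hne, hu⟩
    refine .inr ⟨u.map fun x => [x], by simpa using hne, ?_, ?_, hu⟩
    · intro t ht
      obtain ⟨x, -, rfl⟩ := List.mem_map.1 ht
      exact isBasicWord_singleton x
    · simp [← List.flatMap_def]

variable {K : Type*} [Field K]

omit [LinearOrder V] in
theorem wordVal_mem_SL {u : List (Letter V E)} (hu : u ≠ []) : wordVal K G u ∈ SL K G := by
  induction u with
  | nil => exact (hu rfl).elim
  | cons x u ih =>
    have hx : wordVal K G [x] ∈ SL K G := NonUnitalAlgebra.subset_adjoin K ⟨x, rfl⟩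
    by_cases h : u = []
    · rwa [h]
    · rw [wordVal_cons]
      exact mul_mem hx (ih h)

omit [LinearOrder V] in
theorem SL_le_span {y : UnitalSL K G} (hy : y ∈ SL K G) :
    y ∈ Submodule.span K {z | ∃ u : List (Letter V E), u ≠ [] ∧ wordVal K G u = z} := by
  induction hy using NonUnitalAlgebra.adjoin_induction with
  | mem y hy =>
    obtain ⟨x, rfl⟩ := hy
    exact Submodule.subset_span ⟨[x], by simp, rfl⟩
  | add y z _ _ hy hz => exact add_mem hy hz
  | zero => exact zero_mem _
  | mul y z _ _ hy hz =>
    refine Submodule.span_mono ?_ (Submodule.mul_mem_mul hy hz |> (Submodule.span_mul_span K _ _).le)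
    rintro _ ⟨_, ⟨u, hu, rfl⟩, _, ⟨u', hu', rfl⟩, rfl⟩
    exact ⟨u ++ u', by simp [hu], wordVal_append u u'⟩
  | smul r y _ hy => exact Submodule.smul_mem _ r hy

/-- Leaving out the empty form keeps the unit, which is not a basis word, out of the span. -/
theorem formEval_augmentation_le :
    (augmentation γ K).map (formEval K γ) ≤
      Submodule.span K (Set.range fun u : {u // IsBasisWord γ u} => wordVal K G u.1) := by
  rw [augmentation, Submodule.map_span, Submodule.span_le]
  rintro _ ⟨_, ⟨⟨S, c⟩, hr, hne, rfl⟩, rfl⟩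
  rw [formEval_form hr]
  refine Submodule.subset_span ⟨⟨_, isBasisWord_iff.2 ⟨?_, hr.isIrreducibleWord⟩⟩, rfl⟩
  intro h
  rcases c with _ | u | ⟨b, T, c⟩
  · exact ferWord_ne_nil (fun hS => hne (by rw [hS])) h
  · simp [formWord] at h
  · simp [formWord] at h

theorem wordVal_mem_span_basisWords (hK : ringChar K ≠ 2) (γ : SpecialEdges G)
    {u : List (Letter V E)} (hu : u ≠ []) : wordVal K G u ∈
      Submodule.span K (Set.range fun u : {u // IsBasisWord γ u} => wordVal K G u.1) := by
  refine formEval_augmentation_le ⟨_, ?_, formEval_formRep hK u⟩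
  obtain ⟨x, u', rfl⟩ := List.exists_cons_of_ne_nil hu
  rw [formRep_cons]
  exact letterOp_mem_augmentation x _

theorem linearIndependent_basisWords (K : Type*) [Field K] (γ : SpecialEdges G) :
    LinearIndependent K fun u : {u // IsBasisWord γ u} => wordVal K G u.1 := by
  -- Acting on the empty form is linear and sends each basis word to a single basis vector, so
  -- independence can be tested after applying it.
  let ev : UnitalSL K G →ₗ[K] FormModule γ K :=
    LinearMap.applyₗ (emptyForm K γ) ∘ₗ (formRep γ K).toLinearMap
  have h : ∀ u : {u // IsBasisWord γ u}, ∃ r : {r // IsForm γ r},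
      formWord r.1.1 r.1.2 = u.1 ∧ ev (wordVal K G u.1) = Finsupp.single r 1 := by
    intro u
    obtain ⟨S, c, hr, h1, h2⟩ :=
      exists_form_of_isIrreducibleWord K (isBasisWord_iff.1 u.2).2
    exact ⟨⟨(S, c), hr⟩, h1, h2.trans (form_of_isForm K hr)⟩
  choose r hr hev using h
  -- The form determines its word through `formWord`; uniqueness of the encoding is not required.
  have hinj : Function.Injective r := fun u u' h => Subtype.ext (by rw [← hr u, ← hr u', h])
  refine LinearIndependent.of_comp ev ?_
  have := (Finsupp.basisSingleOne (R := K) (ι := {r // IsForm γ r})).linearIndependent.comp r hinj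
  convert this using 1
  ext1 u
  simp [hev]

end BasisWords

end LeavittSuper

theorem theorem5p2 {K : Type*} [Field K] (hK : ringChar K ≠ 2) {V E : Type*} [LinearOrder V]
    (G : LeavittSuper.SuperGraph V E) (γ : LeavittSuper.SpecialEdges G) :
    ∃ b : Module.Basis {u : List (LeavittSuper.Letter V E) // LeavittSuper.IsBasisWord γ u} K
        (LeavittSuper.SL K G),
      ∀ u, (b u : LeavittSuper.UnitalSL K G) = LeavittSuper.wordVal K G u.1 := by
  open LeavittSuper in
  let f : {u : List (Letter V E) // IsBasisWord γ u} → SL K G := fun u =>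
    ⟨wordVal K G u.1, wordVal_mem_SL (isBasisWord_iff.1 u.2).1⟩
  let i : SL K G →ₗ[K] UnitalSL K G := (SL K G).toSubmodule.subtype
  have hli : LinearIndependent K f := .of_comp i (linearIndependent_basisWords K γ)
  have hsp : ⊤ ≤ Submodule.span K (Set.range f) := by
    rintro ⟨y, hy⟩ -
    have h1 : y ∈ Submodule.span K
        (Set.range fun u : {u // IsBasisWord γ u} => wordVal K G u.1) :=
      Submodule.span_le.2 (by
        rintro _ ⟨u, hu, rfl⟩
        exact wordVal_mem_span_basisWords hK γ hu) (SL_le_span hy)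
    -- Spanning is known in the unital algebra; it is pulled back to the subalgebra along the
    -- injective inclusion `i`.
    have h2 : (Set.range fun u : {u // IsBasisWord γ u} => wordVal K G u.1) =
        i '' Set.range f := by
      rw [← Set.range_comp]
      rfl
    rw [h2, ← Submodule.map_span] at h1
    obtain ⟨z, hz, hzy⟩ := h1
    rwa [← (Subtype.ext hzy : z = ⟨y, hy⟩)]
  exact ⟨.mk hli hsp, fun u => by rw [Module.Basis.mk_apply]⟩
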